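/- For real $\alpha,\alpha'$ and $a>0$ put $a^{(\alpha,\alpha')}=a^{\alpha}$ if $a\le 1$ and $a^{(\alpha,\alpha')}=a^{\alpha'}$ if $a\ge 1$ (for $a=0$ use the convention $0^{(\alpha,\alpha')}=0$ if $\alpha>0$ and $1$ if $\alpha=0$). Write $f\sim g$ if there are constants $a,a'>0$ with $a f\le g\le a' f$ uniformly. Let $n\ge 1$, $m\ge 0$, $0\le\delta_1,\delta_1'<1$ and $\delta_2,\delta_2'\ge 0$. Write points of $\mathbf R^{n}\times\mathbf R^{m}$ as $x=(x_1,x_2)$. Let $c_{\delta_1,\delta_1'},c_{\delta_2,\delta_2'}:\mathbf R^n\to\mathbf R$ be measurable functions with $c_{\delta_i,\delta_i'}(x_1)\sim |x_1|^{(2\delta_i,2\delta_i')}$ for almost every $x_1$, let $$C_\delta(x)=c_{\delta_1,\delta_1'}(x_1)\,I_n\oplus c_{\delta_2,\delta_2'}(x_1)\,I_m ,$$ and let $C=(c_{ij})$ be a matrix of real measurable functions on $\mathbf R^{n}\times\mathbf R^{m}$ with $C\sim C_\delta$ almost everywhere in the sense of symmetric matrices. The Riemannian distance with coefficients $C$ is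 $$d_C(y;z)=\sup\Big\{\psi(y)-\psi(z):\ \psi\in W^{1,\infty}(\mathbf R^{n}\times\mathbf R^{m}),\ \sum_{i,j}c_{ij}\,(\partial_i\psi)(\partial_j\psi)\le 1\ \text{a.e.}\Big\}\in[0,\infty],$$ where $\psi$ is evaluated through its continuous representative; put $B_C(x;r)=\{y: d_C(x;y)<r\}$ and let $|\cdot|$ denote Lebesgue measure. The distance $d_\delta$ and the balls $B_\delta$ are those with coefficients $C_\delta$. Let $\rho=1+\delta_2-\delta_1$, $\rho'=1+\delta_2'-\delta_1'$, $\gamma=\delta_2/\rho$, $\gamma'=\delta_2'/\rho'$, and define $$\Delta_\delta(x;y)=\begin{cases}|x_2-y_2|\big/(|x_1|+|y_1|)^{(\delta_2,\delta_2')} & \text{if } |x_2-y_2|\le(|x_1|+|y_1|)^{(\rho,\rho')},\\ |x_2-y_2|^{(1-\gamma,1-\gamma')} & \text{if } |x_2-y_2|\ge(|x_1|+|y_1|)^{(\rho,\rho')},\end{cases}$$ $$D_\delta(x;y)=|x_1-y_1|\big/(|x_1|+|y_1|)^{(\delta_1,\delta_1')}+\Delta_\delta(x;y),$$ with the convention that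 a quotient with vanishing numerator is $0$. Then $$d_\delta(x;y)\sim D_\delta(x;y)\qquad\text{and}\qquad d_C(x;y)\sim D_\delta(x;y)$$ uniformly for $x,y\in\mathbf R^{n}\times\mathbf R^{m}$. Moreover, uniformly for $x\in\mathbf R^{n}\times\mathbf R^{m}$ and $r>0$, the balls $B=B_\delta$, and likewise the balls $B=B_C$, satisfy $$|B(x;r)|\sim\begin{cases} r^{(D,D')} & \text{if } r\ge|x_1|^{(1-\delta_1,1-\delta_1')},\\ r^{n+m}\,|x_1|^{(\beta,\beta')} & \text{if } r\le|x_1|^{(1-\delta_1,1-\delta_1')},\end{cases}$$ where $D=(n+m(1+\delta_2-\delta_1))(1-\delta_1)^{-1}$, $D'=(n+m(1+\delta_2'-\delta_1'))(1-\delta_1')^{-1}$, $\beta=n\delta_1+m\delta_2$ and $\beta'=n\delta_1'+m\delta_2'$. -/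

import Mathlib

open MeasureTheory
open scoped ENNReal NNReal ContDiff

noncomputable section

/-- The function `g` is a weak partial derivative of `ψ` in the `i`-th coordinate direction of
`ℝ^ι`: `∫ ψ ∂ᵢφ = - ∫ g φ` for every smooth compactly supported `φ`. -/
def IsWeakPartial {ι : Type*} [Fintype ι] [DecidableEq ι]
    (i : ι) (ψ g : EuclideanSpace ℝ ι → ℝ) : Prop :=
  ∀ φ : EuclideanSpace ℝ ι → ℝ, ContDiff ℝ ∞ φ → HasCompactSupport φ →
    ∫ x, ψ x * fderiv ℝ φ x (EuclideanSpace.single i 1) = - ∫ x, g x * φ x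

/-- `ψ` is (the continuous representative of) an element of `W^{1,∞}(ℝ^ι)`, with weak gradient `g`.
Every class in `W^{1,∞}` has a unique continuous representative, and it is this representative
that is evaluated at points in the definition of the Riemannian distance. -/
structure IsW1Infty {ι : Type*} [Fintype ι] [DecidableEq ι]
    (ψ : EuclideanSpace ℝ ι → ℝ) (g : ι → EuclideanSpace ℝ ι → ℝ) : Prop where
  continuous : Continuous ψ
  memLp : MemLp ψ ∞ volume
  grad_memLp : ∀ i, MemLp (g i) ∞ volume
  weak : ∀ i, IsWeakPartial i ψ (g i)

/-- The set of trial functions `ψ ∈ W^{1,∞}` with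
`∑ᵢⱼ cᵢⱼ (∂ᵢψ) (∂ⱼψ) ≤ 1` almost everywhere. -/
def trialFunctions {ι : Type*} [Fintype ι] [DecidableEq ι]
    (C : EuclideanSpace ℝ ι → Matrix ι ι ℝ) : Set (EuclideanSpace ℝ ι → ℝ) :=
  {ψ | ∃ g : ι → EuclideanSpace ℝ ι → ℝ, IsW1Infty ψ g ∧
    ∀ᵐ x, ∑ i, ∑ j, C x i j * g i x * g j x ≤ 1}

/-- The Riemannian distance `sup (ψ y - ψ z)` over the trial functions, as an element of `[0, ∞]`.
(The zero function is a trial function, so the supremum is never negative and truncating negative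
differences at `0` does not change it.) -/
def riemDist {ι : Type*} [Fintype ι] [DecidableEq ι]
    (C : EuclideanSpace ℝ ι → Matrix ι ι ℝ) (y z : EuclideanSpace ℝ ι) : ℝ≥0∞ :=
  ⨆ ψ ∈ trialFunctions C, ENNReal.ofReal (ψ y - ψ z)

/-- The open ball `{y | d(x ; y) < r}` of the Riemannian distance. -/
def riemBall {ι : Type*} [Fintype ι] [DecidableEq ι]
    (C : EuclideanSpace ℝ ι → Matrix ι ι ℝ) (x : EuclideanSpace ℝ ι) (r : ℝ) :
    Set (EuclideanSpace ℝ ι) :=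
  {y | riemDist C x y < ENNReal.ofReal r}

/-- `a^(α,α')`: it is `a^α` for `a ≤ 1` and `a^α'` for `a ≥ 1`. -/
def twoPow (a α α' : ℝ) : ℝ := if a ≤ 1 then a ^ α else a ^ α'

/-- `ℝⁿ × ℝᵐ` with its Euclidean structure and Lebesgue measure. -/
abbrev RnRm (n m : ℕ) : Type := EuclideanSpace ℝ (Fin n ⊕ Fin m)

/-- The component `x₁ ∈ ℝⁿ` of `x = (x₁, x₂)`. -/
def comp₁ {n m : ℕ} (x : RnRm n m) : EuclideanSpace ℝ (Fin n) :=
  WithLp.toLp 2 fun i => x (Sum.inl i)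

/-- The component `x₂ ∈ ℝᵐ` of `x = (x₁, x₂)`. -/
def comp₂ {n m : ℕ} (x : RnRm n m) : EuclideanSpace ℝ (Fin m) :=
  WithLp.toLp 2 fun j => x (Sum.inr j)

/-- The block diagonal coefficient matrix `c₁(x₁) Iₙ ⊕ c₂(x₁) Iₘ`. -/
def blockCoeff {n m : ℕ} (c₁ c₂ : EuclideanSpace ℝ (Fin n) → ℝ) (x : RnRm n m) :
    Matrix (Fin n ⊕ Fin m) (Fin n ⊕ Fin m) ℝ :=
  Matrix.fromBlocks (c₁ (comp₁ x) • 1) 0 0 (c₂ (comp₁ x) • 1)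

/-- `c` is an almost everywhere positive measurable function on `ℝⁿ` with
`c(x) ∼ |x|^(2δ,2δ')`. -/
def IsGrushinCoeff {n : ℕ} (δ δ' : ℝ) (c : EuclideanSpace ℝ (Fin n) → ℝ) : Prop :=
  AEMeasurable c volume ∧
  ∃ a a' : ℝ, 0 < a ∧ 0 < a' ∧ ∀ᵐ x,
    a * twoPow ‖x‖ (2 * δ) (2 * δ') ≤ c x ∧ c x ≤ a' * twoPow ‖x‖ (2 * δ) (2 * δ')

/-- Equivalence `C ∼ C'` of fields of symmetric matrices, in the sense of the order of positive
semidefinite matrices: `a C' ≤ C ≤ a' C'` almost everywhere, for constants `a, a' > 0`. -/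
def CoeffEquiv {ι : Type*} [Fintype ι] (C C' : EuclideanSpace ℝ ι → Matrix ι ι ℝ) : Prop :=
  ∃ a a' : ℝ, 0 < a ∧ 0 < a' ∧ ∀ᵐ x,
    (C x - a • C' x).PosSemidef ∧ (a' • C' x - C x).PosSemidef

/-- The function `Δ_δ(x₁,x₂;y₁,y₂)`, with `ρ = 1+δ₂-δ₁`, `ρ' = 1+δ₂'-δ₁'`, `γ = δ₂/ρ`,
`γ' = δ₂'/ρ'`. If `x₁ = y₁ = 0` and `x₂ = y₂` the value is `0`. -/
def grushinΔ {n m : ℕ} (δ₁ δ₂ δ₁' δ₂' : ℝ) (x y : RnRm n m) : ℝ :=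
  let ρ := 1 + δ₂ - δ₁
  let ρ' := 1 + δ₂' - δ₁'
  let γ := δ₂ / ρ
  let γ' := δ₂' / ρ'
  let s := ‖comp₁ x‖ + ‖comp₁ y‖
  let t := ‖comp₂ x - comp₂ y‖
  if t ≤ twoPow s ρ ρ' then t / twoPow s δ₂ δ₂' else twoPow t (1 - γ) (1 - γ')

/-- `D_δ = |x₁-y₁| / (|x₁|+|y₁|)^(δ₁,δ₁') + Δ_δ`. The first term is `0` if `x₁ = y₁ = 0`. -/
def grushinD {n m : ℕ} (δ₁ δ₂ δ₁' δ₂' : ℝ) (x y : RnRm n m) : ℝ :=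
  ‖comp₁ x - comp₁ y‖ / twoPow (‖comp₁ x‖ + ‖comp₁ y‖) δ₁ δ₁' + grushinΔ δ₁ δ₂ δ₁' δ₂' x y

/-- The dimension `(n + m(1+δ₂-δ₁)) / (1-δ₁)`. -/
def grushinDim (n m : ℕ) (δ₁ δ₂ : ℝ) : ℝ := (n + m * (1 + δ₂ - δ₁)) / (1 - δ₁)

/-- The Riemannian distance of `C` is equivalent to `D_δ`, uniformly on `ℝⁿ × ℝᵐ`. In particular
it is finite. -/
def DistEquivGrushin {n m : ℕ} (δ₁ δ₂ δ₁' δ₂' : ℝ)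
    (C : RnRm n m → Matrix (Fin n ⊕ Fin m) (Fin n ⊕ Fin m) ℝ) : Prop :=
  ∃ a a' : ℝ, 0 < a ∧ 0 < a' ∧ ∀ x y : RnRm n m,
    ENNReal.ofReal (a * grushinD δ₁ δ₂ δ₁' δ₂' x y) ≤ riemDist C x y ∧
    riemDist C x y ≤ ENNReal.ofReal (a' * grushinD δ₁ δ₂ δ₁' δ₂' x y)

/-- The volume estimates for the Riemannian balls of `C`, uniformly in the centre and in the radius
`r > 0`: `|B(x;r)| ∼ r^(D,D')` if `r ≥ |x₁|^(1-δ₁,1-δ₁')` and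
`|B(x;r)| ∼ r^{n+m} |x₁|^(β,β')` if `r ≤ |x₁|^(1-δ₁,1-δ₁')`. -/
def BallVolumeEquivGrushin {n m : ℕ} (δ₁ δ₂ δ₁' δ₂' : ℝ)
    (C : RnRm n m → Matrix (Fin n ⊕ Fin m) (Fin n ⊕ Fin m) ℝ) : Prop :=
  ∃ a a' : ℝ, 0 < a ∧ 0 < a' ∧ ∀ (x : RnRm n m) (r : ℝ), 0 < r →
    (twoPow ‖comp₁ x‖ (1 - δ₁) (1 - δ₁') ≤ r →
      ENNReal.ofReal (a * twoPow r (grushinDim n m δ₁ δ₂) (grushinDim n m δ₁' δ₂'))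
          ≤ volume (riemBall C x r) ∧
      volume (riemBall C x r) ≤
        ENNReal.ofReal (a' * twoPow r (grushinDim n m δ₁ δ₂) (grushinDim n m δ₁' δ₂'))) ∧
    (r ≤ twoPow ‖comp₁ x‖ (1 - δ₁) (1 - δ₁') →
      ENNReal.ofReal
          (a * (r ^ (n + m) * twoPow ‖comp₁ x‖ (n * δ₁ + m * δ₂) (n * δ₁' + m * δ₂')))
          ≤ volume (riemBall C x r) ∧
      volume (riemBall C x r) ≤
        ENNReal.ofReal
          (a' * (r ^ (n + m) * twoPow ‖comp₁ x‖ (n * δ₁ + m * δ₂) (n * δ₁' + m * δ₂'))))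

end

/-! Where `|x₁|` has size `Y`, moving `x₁` costs about `|x₁-y₁|/Y^(δ₁,δ₁')` and moving `x₂` about
`|x₂-y₂|/Y^(δ₂,δ₂')`. Both coefficient fields enter only through the two-sided bound
`HasGrushinBounds`, so a single argument serves `C_δ` and `C`. Upper bound: a trial function has
bounded weak partials away from `x₁ = 0`, so mollification controls its increments along segments
avoiding that set (`trialFunctions_abs_sub_le`). Since `δ₁, δ₁' < 1`, a dyadic chain reaches `x₁ =
0` at the finite cost `|x₁|^(1-δ₁,1-δ₁')`. To change `x₂` one moves to the level `|x₁| ∼ S`, with `S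
= max(|x₁|+|y₁|, |x₂-y₂|^(1/ρ,1/ρ'))`. When the second entry dominates, going out to `S` and moving
`x₂` there both cost about `S^(1-δ₁,1-δ₁')`. Summing the legs gives `D_δ`
(`IsSegmentLipschitz.abs_sub_le_grushinD`). Lower bound: one explicit trial function detects each
term of `D_δ`, namely a truncated distance in `x₁`, and a truncated distance in `x₂` times a cut-off
in `|x₁|` at scale `S`. Volume: this step uses only `d ∼ D_δ`. Put `Y = |x₁|` for small balls and `Y
= r^(1/(1-δ₁),1/(1-δ₁'))` for large ones. A ball lies between two boxes with sides comparable to `r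
Y^(δ₁,δ₁')` in `ℝⁿ` and `r Y^(δ₂,δ₂')` in `ℝᵐ`, so its volume is comparable to `r^(n+m) Y^(β,β')`.
-/

section TwoPow

/-! ### Calculus of the two-exponent power. -/

variable {a b l α α' β β' θ θ' : ℝ}

lemma twoPow_pos (ha : 0 < a) : 0 < twoPow a α α' := by
  unfold twoPow; split_ifs <;> positivity

lemma twoPow_nonneg (ha : 0 ≤ a) : 0 ≤ twoPow a α α' := by
  unfold twoPow; split_ifs <;> positivity

lemma twoPow_one_one : twoPow a 1 1 = a := by
  unfold twoPow; split_ifs <;> simp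

lemma twoPow_add (ha : 0 < a) :
    twoPow a (α + β) (α' + β') = twoPow a α α' * twoPow a β β' := by
  unfold twoPow; split_ifs <;> exact Real.rpow_add ha _ _

lemma twoPow_two_mul (ha : 0 ≤ a) : twoPow a (2 * α) (2 * α') = twoPow a α α' ^ 2 := by
  unfold twoPow; split_ifs <;> rw [mul_comm, Real.rpow_mul ha] <;> norm_cast

lemma twoPow_pow (ha : 0 ≤ a) (k : ℕ) : twoPow a α α' ^ k = twoPow a (k * α) (k * α') := by
  unfold twoPow; split_ifs <;> rw [mul_comm, Real.rpow_mul ha, Real.rpow_natCast]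

lemma twoPow_mono (ha : 0 ≤ a) (hab : a ≤ b) (hα : 0 ≤ α) (hα' : 0 ≤ α') :
    twoPow a α α' ≤ twoPow b α α' := by
  unfold twoPow
  split_ifs with h1 h2 h2
  · exact Real.rpow_le_rpow ha hab hα
  · exact (Real.rpow_le_one ha h1 hα).trans (Real.one_le_rpow (by linarith) hα')
  · linarith
  · exact Real.rpow_le_rpow ha hab hα'

lemma twoPow_twoPow (ha : 0 ≤ a) (hβ : 0 < β) (hβ' : 0 < β') :
    twoPow (twoPow a β β') α α' = twoPow a (β * α) (β' * α') := by
  unfold twoPow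
  by_cases h : a ≤ 1
  · rw [if_pos h, if_pos h, if_pos (Real.rpow_le_one ha h hβ.le), ← Real.rpow_mul ha]
  · have : ¬ a ^ β' ≤ 1 := not_le.2 (Real.one_lt_rpow (not_le.1 h) hβ')
    rw [if_neg h, if_neg h, if_neg this, ← Real.rpow_mul ha]

lemma twoPow_inv_twoPow (ha : 0 ≤ a) (hβ : 0 < β) (hβ' : 0 < β') :
    twoPow (twoPow a β β') β⁻¹ β'⁻¹ = a := by
  rw [twoPow_twoPow ha hβ hβ', mul_inv_cancel₀ hβ.ne', mul_inv_cancel₀ hβ'.ne', twoPow_one_one]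

lemma twoPow_twoPow_inv (ha : 0 ≤ a) (hβ : 0 < β) (hβ' : 0 < β') :
    twoPow (twoPow a β⁻¹ β'⁻¹) β β' = a := by
  rw [twoPow_twoPow ha (inv_pos.2 hβ) (inv_pos.2 hβ'), inv_mul_cancel₀ hβ.ne',
    inv_mul_cancel₀ hβ'.ne', twoPow_one_one]

/-- The two-exponent power is not homogeneous, because a dilation may carry `a` across `1`. The
exponent `α + α'` dominates in every case, which makes all changes of scale by a bounded factor
harmless. -/
lemma twoPow_dilate_le (hl : 1 ≤ l) (ha : 0 ≤ a) (hα : 0 ≤ α) (hα' : 0 ≤ α') :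
    twoPow (l * a) α α' ≤ l ^ (α + α') * twoPow a α α' := by
  have hl0 : 0 ≤ l := by linarith
  unfold twoPow
  split_ifs with h1 h2 h2
  · rw [Real.mul_rpow hl0 ha]
    gcongr ?_ * ?_
    exact Real.rpow_le_rpow_of_exponent_le hl (by linarith)
  · nlinarith
  · have h3 : 1 ≤ l * a := by linarith
    have ha0 : 0 < a := by
      rcases ha.eq_or_lt with h | h
      · subst h; simp at h1
      · exact h
    calc (l * a) ^ α' ≤ (l * a) ^ (α + α') := Real.rpow_le_rpow_of_exponent_le h3 (by linarith)
      _ = l ^ (α + α') * a ^ (α + α') := Real.mul_rpow hl0 ha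
      _ ≤ l ^ (α + α') * a ^ α := by
        gcongr ?_ * ?_
        exact Real.rpow_le_rpow_of_exponent_ge ha0 h2 (by linarith)
  · rw [Real.mul_rpow hl0 ha]
    gcongr ?_ * ?_
    exact Real.rpow_le_rpow_of_exponent_le hl (by linarith)

/-- Any `θ` below both exponents survives a crossing of `1`. With `θ > 0` this gives the decay used
for dyadic sums and for shrinking boxes. -/
lemma twoPow_contract_le (hl : 0 < l) (hl1 : l ≤ 1) (ha : 0 ≤ a)
    (hα : θ ≤ α) (hα' : θ ≤ α') :
    twoPow (l * a) α α' ≤ l ^ θ * twoPow a α α' := by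
  unfold twoPow
  split_ifs with h1 h2 h2
  · rw [Real.mul_rpow hl.le ha]
    gcongr ?_ * ?_
    exact Real.rpow_le_rpow_of_exponent_ge hl hl1 hα
  · have ha1 : 1 < a := not_le.1 h2
    calc (l * a) ^ α ≤ (l * a) ^ θ :=
          Real.rpow_le_rpow_of_exponent_ge (by positivity) h1 hα
      _ = l ^ θ * a ^ θ := Real.mul_rpow hl.le ha
      _ ≤ l ^ θ * a ^ α' := by
        gcongr ?_ * ?_
        exact Real.rpow_le_rpow_of_exponent_le ha1.le hα'
  · nlinarith
  · rw [Real.mul_rpow hl.le ha]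
    gcongr ?_ * ?_
    exact Real.rpow_le_rpow_of_exponent_ge hl hl1 hα'

/-- Apply the inverse power, which has exponents `θ⁻¹, θ'⁻¹`, and absorb `l` by dilation. -/
lemma le_of_twoPow_le (ha : 0 ≤ a) (hb : 0 ≤ b) (hl : 1 ≤ l) (hθ : 0 < θ) (hθ' : 0 < θ')
    (h : twoPow a θ θ' ≤ l * twoPow b θ θ') : a ≤ l ^ (θ⁻¹ + θ'⁻¹) * b := by
  have h1 := twoPow_mono (twoPow_nonneg ha) h (inv_pos.2 hθ).le (inv_pos.2 hθ').le
  have h2 := twoPow_dilate_le hl (twoPow_nonneg hb (α := θ) (α' := θ'))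
    (inv_pos.2 hθ).le (inv_pos.2 hθ').le
  rw [twoPow_inv_twoPow ha hθ hθ'] at h1
  rw [twoPow_inv_twoPow hb hθ hθ'] at h2
  exact h1.trans h2

/-- The quotient `a / a^(δ,δ')` is `a^(1-δ,1-δ')`. -/
lemma twoPow_one_sub_mul {δ δ' : ℝ} (ha : 0 < a) :
    twoPow a (1 - δ) (1 - δ') * twoPow a δ δ' = a := by
  rw [← twoPow_add ha]; simp [twoPow_one_one]

end TwoPow

/-! ### Weak gradients, mollification and Lipschitz functions. -/

section WeakGradient

variable {ι : Type*} [Fintype ι] [DecidableEq ι]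

/-- Partial integration against the translates and reflections of a test function. -/
lemma integral_fderiv_sub_mul {ψ : EuclideanSpace ℝ ι → ℝ} {g : ι → EuclideanSpace ℝ ι → ℝ}
    (hψ : IsW1Infty ψ g) {f : EuclideanSpace ℝ ι → ℝ} (hfs : ContDiff ℝ ∞ f)
    (hfc : HasCompactSupport f) (x v : EuclideanSpace ℝ ι) :
    ∫ t, fderiv ℝ f (x - t) v * ψ t = ∫ t, f (x - t) * ∑ i, v i * g i t := by
  set q : EuclideanSpace ℝ ι → ℝ := fun t => f (x - t) with hq
  have hqs : ContDiff ℝ ∞ q := hfs.comp (contDiff_const.sub contDiff_id)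
  have hqc : HasCompactSupport q := hfc.comp_homeomorph (Homeomorph.subLeft x)
  have hqd : ∀ t w, fderiv ℝ q t w = - fderiv ℝ f (x - t) w := fun t w => by
    have h1 : HasFDerivAt (fun t : EuclideanSpace ℝ ι => x - t)
        (-ContinuousLinearMap.id ℝ _) t := (hasFDerivAt_id t).const_sub x
    have h2 := ((hfs.differentiable (by simp)).differentiableAt (x := x - t)).hasFDerivAt
    have h3 : HasFDerivAt q _ t := h2.comp t h1
    rw [h3.fderiv]; simp
  have hvs : v = ∑ i, v i • EuclideanSpace.single i (1 : ℝ) := by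
    ext j; simp [Pi.single_apply]
  have hI1 : ∀ i, Integrable
      (fun t => v i * (ψ t * fderiv ℝ q t (EuclideanSpace.single i 1))) volume := fun i => by
    refine Continuous.integrable_of_hasCompactSupport ?_ ?_
    · exact continuous_const.mul (hψ.continuous.mul
        ((hqs.continuous_fderiv (by simp)).clm_apply continuous_const))
    · exact ((hqc.fderiv_apply ℝ _).mul_left).mul_left
  have hqi : Integrable q volume := hqs.continuous.integrable_of_hasCompactSupport hqc
  have hI2 : ∀ i, Integrable (fun t => v i * (g i t * q t)) volume := fun i =>
    (hqi.mul_of_top_right (hψ.grad_memLp i)).const_mul _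
  calc _ = ∫ t, - ∑ i, v i * (ψ t * fderiv ℝ q t (EuclideanSpace.single i 1)) := by
        refine integral_congr_ae (Filter.Eventually.of_forall fun t => ?_)
        have : fderiv ℝ f (x - t) v = - ∑ i, v i * fderiv ℝ q t (EuclideanSpace.single i 1) := by
          conv_lhs => rw [hvs]
          simp [hqd]
        simp only [this, neg_mul, Finset.sum_mul]
        congr 1
        exact Finset.sum_congr rfl fun i _ => by ring
    _ = ∑ i, v i * ∫ t, g i t * q t := by
        rw [integral_neg, integral_finsetSum _ fun i _ => hI1 i, ← Finset.sum_neg_distrib]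
        refine Finset.sum_congr rfl fun i _ => ?_
        rw [integral_const_mul, hψ.weak i q hqs hqc]; ring
    _ = _ := by
        simp_rw [← integral_const_mul]
        rw [← integral_finsetSum _ fun i _ => hI2 i]
        congr 1; ext t; rw [Finset.mul_sum]
        exact Finset.sum_congr rfl fun i _ => by ring

-- The derivative of the mollified function falls on the smooth kernel. The definition of the weak
-- gradient then transfers it to `g`.
open scoped Convolution in
lemma hasDerivAt_convolution_segment {ψ : EuclideanSpace ℝ ι → ℝ}
    {g : ι → EuclideanSpace ℝ ι → ℝ}
    (hψ : IsW1Infty ψ g) {f : EuclideanSpace ℝ ι → ℝ} (hfs : ContDiff ℝ ∞ f)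
    (hfc : HasCompactSupport f) (z v : EuclideanSpace ℝ ι) (τ : ℝ) :
    HasDerivAt (fun τ : ℝ => (f ⋆[ContinuousLinearMap.lsmul ℝ ℝ, volume] ψ) (z + τ • v))
      (∫ t, f (z + τ • v - t) * ∑ i, v i * g i t) τ := by
  have hloc : LocallyIntegrable ψ volume := hψ.continuous.locallyIntegrable
  have hder := hfc.hasFDerivAt_convolution_left (ContinuousLinearMap.lsmul ℝ ℝ)
    (hfs.of_le (by simp)) hloc (z + τ • v)
  have h1 : HasDerivAt (fun τ : ℝ => z + τ • v) v τ := by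
    simpa using ((hasDerivAt_id τ).smul_const v).const_add z
  have hint : Integrable (fun t => ((ContinuousLinearMap.lsmul ℝ ℝ).precompL
      (EuclideanSpace ℝ ι)) (fderiv ℝ f t) (ψ (z + τ • v - t))) volume :=
    HasCompactSupport.convolutionExists_left
      (L := (ContinuousLinearMap.lsmul ℝ ℝ).precompL (EuclideanSpace ℝ ι))
      (hfc.fderiv ℝ) (hfs.continuous_fderiv (by simp)) hloc (z + τ • v)
  have hval : ((fderiv ℝ f ⋆[(ContinuousLinearMap.lsmul ℝ ℝ).precompL _, volume] ψ)
      (z + τ • v)) v = ∫ t, f (z + τ • v - t) * ∑ i, v i * g i t := by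
    rw [← integral_fderiv_sub_mul hψ hfs hfc, convolution_def,
      ContinuousLinearMap.integral_apply hint,
      ← integral_sub_left_eq_self (fun t => fderiv ℝ f (z + τ • v - t) v * ψ t) volume (z + τ • v)]
    refine integral_congr_ae (Filter.Eventually.of_forall fun t => ?_)
    simp [ContinuousLinearMap.precompL_apply]
  rw [← hval]
  exact hder.comp_hasDerivAt τ h1

/-- The increment of a continuous function along a segment is controlled by the essential supremum,
near the segment, of the weak derivative in the direction of the segment. -/
lemma abs_sub_le_of_isW1Infty {ψ : EuclideanSpace ℝ ι → ℝ} {g : ι → EuclideanSpace ℝ ι → ℝ}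
    (hψ : IsW1Infty ψ g) (y z : EuclideanSpace ℝ ι) {ε M : ℝ} (hε : 0 < ε)
    (hM : ∀ᵐ x, (∃ τ ∈ Set.Icc (0 : ℝ) 1, dist x (z + τ • (y - z)) < ε) →
      |∑ i, (y i - z i) * g i x| ≤ M) : |ψ y - ψ z| ≤ M := by
  -- With `k + 2` in the denominator every outer radius is strictly below `ε`, so the mollification
  -- on the segment sees only the tube where the bound `M` holds. The tube is needed because an
  -- almost everywhere bound may say nothing on the segment itself.
  let φ : ℕ → ContDiffBump (0 : EuclideanSpace ℝ ι) := fun k =>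
    ⟨ε / (k + 2) / 2, ε / (k + 2), by positivity, half_lt_self (by positivity)⟩
  have hout : ∀ k, (φ k).rOut < ε := fun k => by
    show ε / ((k : ℝ) + 2) < ε
    apply div_lt_self hε; have : (0 : ℝ) ≤ k := k.cast_nonneg; linarith
  have hφ : Filter.Tendsto (fun k => (φ k).rOut) Filter.atTop (nhds 0) := by
    show Filter.Tendsto (fun k : ℕ => ε / ((k : ℝ) + 2)) Filter.atTop (nhds 0)
    apply Filter.Tendsto.div_atTop tendsto_const_nhds
    exact Filter.tendsto_atTop_add_const_right _ _ tendsto_natCast_atTop_atTop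
  have hlim := ContDiffBump.convolution_tendsto_right_of_continuous (μ := volume) hφ hψ.continuous
  set v := y - z with hv
  refine le_of_tendsto' ((hlim y).sub (hlim z)).abs fun k => ?_
  set f := (φ k).normed (volume : Measure (EuclideanSpace ℝ ι)) with hf
  have hfs : ContDiff ℝ ∞ f := (φ k).contDiff_normed
  have hfc : HasCompactSupport f := (φ k).hasCompactSupport_normed
  have hbd : ∀ τ ∈ Set.Icc (0 : ℝ) 1, |∫ t, f (z + τ • v - t) * ∑ i, v i * g i t| ≤ M := by
    intro τ hτ
    have hfi : Integrable f volume := hfs.continuous.integrable_of_hasCompactSupport hfc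
    have h1 : ∫ t, f (z + τ • v - t) * M = M := by
      rw [integral_mul_const, integral_sub_left_eq_self f volume, (φ k).integral_normed, one_mul]
    rw [← Real.norm_eq_abs]
    refine (norm_integral_le_of_norm_le ((hfi.comp_sub_left _).mul_const M) ?_).trans_eq h1
    filter_upwards [hM] with t ht
    have hf0 : 0 ≤ f (z + τ • v - t) := (φ k).nonneg_normed _
    rw [norm_mul, Real.norm_of_nonneg hf0, Real.norm_eq_abs]
    by_cases h : f (z + τ • v - t) = 0
    · simp [h]
    · have : z + τ • v - t ∈ Function.support ((φ k).normed volume) := h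
      rw [(φ k).support_normed_eq, mem_ball_zero_iff, ← dist_eq_norm, dist_comm] at this
      exact mul_le_mul_of_nonneg_left (by simpa [hv] using ht ⟨τ, hτ, this.trans (hout k)⟩) hf0
  have := norm_image_sub_le_of_norm_deriv_le_segment_01'
    (fun τ _ => (hasDerivAt_convolution_segment hψ hfs hfc z v τ).hasDerivWithinAt)
    (fun τ hτ => hbd τ ⟨hτ.1, hτ.2.le⟩)
  simpa [hv] using this

/-- A bounded Lipschitz function belongs to `W^{1,∞}`, its weak gradient consisting of the
directional derivatives. -/
lemma isW1Infty_of_lipschitzWith {ψ : EuclideanSpace ℝ ι → ℝ} {K : ℝ≥0} (hL : LipschitzWith K ψ)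
    {b : ℝ} (hb : ∀ x, |ψ x| ≤ b) :
    IsW1Infty ψ (fun i x => lineDeriv ℝ ψ x (EuclideanSpace.single i 1)) where
  continuous := hL.continuous
  memLp := memLp_top_of_bound hL.continuous.aestronglyMeasurable b (Filter.Eventually.of_forall hb)
  grad_memLp i := hL.memLp_lineDeriv _
  weak i φ hφ hφc := by
    obtain ⟨D, hD⟩ := ContDiff.lipschitzWith_of_hasCompactSupport hφc hφ (by simp)
    rw [hL.integral_lineDeriv_mul_eq hD hφc, ← integral_neg]
    congr 1; ext x
    rw [(hφ.differentiable (by simp)).differentiableAt.lineDeriv_eq_fderiv]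
    simp [mul_comm]

lemma abs_lineDeriv_le {E : Type*} [AddCommGroup E] [Module ℝ E] {ψ : E → ℝ} {x v : E} {K : ℝ}
    (h : ∀ t : ℝ, |ψ (x + t • v) - ψ x| ≤ K * |t|) : |lineDeriv ℝ ψ x v| ≤ K := by
  have hK : 0 ≤ K := by simpa using (abs_nonneg _).trans (h 1)
  refine norm_deriv_le_of_lip' (f := fun t : ℝ => ψ (x + t • v)) hK (Filter.Eventually.of_forall fun t => ?_)
  simpa using h t

lemma lineDeriv_eq_zero_of_eventually {E : Type*} [NormedAddCommGroup E] [NormedSpace ℝ E]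
    {ψ : E → ℝ} {x : E} {c : ℝ} (h : ∀ᶠ y in nhds x, ψ y = c) (v : E) : lineDeriv ℝ ψ x v = 0 := by
  have : ψ =ᶠ[nhds x] fun _ => c := h
  rw [this.lineDeriv_eq]; simp [lineDeriv]

end WeakGradient

/-! ### The splitting of `ℝⁿ × ℝᵐ`. -/

section Components

variable {n m : ℕ}

/-- The point `(a, w)` of `ℝⁿ × ℝᵐ`. -/
noncomputable def joinComp (a : EuclideanSpace ℝ (Fin n)) (w : EuclideanSpace ℝ (Fin m)) : RnRm n m :=
  WithLp.toLp 2 (Sum.elim a w)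

@[simp] lemma comp₁_joinComp (a : EuclideanSpace ℝ (Fin n)) (w : EuclideanSpace ℝ (Fin m)) :
    comp₁ (joinComp a w) = a := rfl

@[simp] lemma comp₂_joinComp (a : EuclideanSpace ℝ (Fin n)) (w : EuclideanSpace ℝ (Fin m)) :
    comp₂ (joinComp a w) = w := rfl

@[simp] lemma joinComp_comp (x : RnRm n m) : joinComp (comp₁ x) (comp₂ x) = x := by
  ext i; rcases i with i | i <;> rfl

lemma comp₁_add (x y : RnRm n m) : comp₁ (x + y) = comp₁ x + comp₁ y := rfl
lemma comp₁_sub (x y : RnRm n m) : comp₁ (x - y) = comp₁ x - comp₁ y := rfl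
lemma comp₂_sub (x y : RnRm n m) : comp₂ (x - y) = comp₂ x - comp₂ y := rfl
lemma comp₁_smul (t : ℝ) (x : RnRm n m) : comp₁ (t • x) = t • comp₁ x := rfl
lemma comp₂_smul (t : ℝ) (x : RnRm n m) : comp₂ (t • x) = t • comp₂ x := rfl

lemma norm_sq_eq_comp (x : RnRm n m) : ‖x‖ ^ 2 = ‖comp₁ x‖ ^ 2 + ‖comp₂ x‖ ^ 2 := by
  simp [EuclideanSpace.norm_sq_eq, comp₁, comp₂]

lemma norm_comp₁_le (x : RnRm n m) : ‖comp₁ x‖ ≤ ‖x‖ := by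
  have := norm_sq_eq_comp x
  exact abs_le_of_sq_le_sq' (by nlinarith [sq_nonneg ‖comp₂ x‖]) (norm_nonneg _) |>.2

lemma norm_comp₂_le (x : RnRm n m) : ‖comp₂ x‖ ≤ ‖x‖ := by
  have := norm_sq_eq_comp x
  exact abs_le_of_sq_le_sq' (by nlinarith [sq_nonneg ‖comp₁ x‖]) (norm_nonneg _) |>.2

lemma abs_apply_le_norm {ι : Type*} [Fintype ι] (x : EuclideanSpace ℝ ι) (i : ι) :
    |x i| ≤ ‖x‖ := by
  simpa using PiLp.norm_apply_le x i

lemma continuous_comp₁ : Continuous (comp₁ : RnRm n m → EuclideanSpace ℝ (Fin n)) := by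
  unfold comp₁; fun_prop

lemma continuous_joinComp :
    Continuous fun a : EuclideanSpace ℝ (Fin n) × EuclideanSpace ℝ (Fin m) =>
      joinComp a.1 a.2 := by
  unfold joinComp
  refine (PiLp.continuous_toLp 2 _).comp (continuous_pi fun i => ?_)
  rcases i with i | i <;> simp <;> fun_prop

/-- The projection is linear and surjective, so preimages of null sets are null. -/
lemma ae_comp₁ {p : EuclideanSpace ℝ (Fin n) → Prop} (hp : ∀ᵐ a, p a) :
    ∀ᵐ x : RnRm n m, p (comp₁ x) := by
  let L : RnRm n m →ₗ[ℝ] EuclideanSpace ℝ (Fin n) :=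
    { toFun := comp₁, map_add' := comp₁_add, map_smul' := comp₁_smul }
  have hL : Function.Surjective L := fun a => ⟨joinComp a 0, rfl⟩
  obtain ⟨s, hs, hsm, h0⟩ := (exists_measurable_superset_of_null (ae_iff.1 hp))
  have h1 := (ae_comp_linearMap_mem_iff L volume volume hL hsm.compl).2
    (by rw [ae_iff]; simpa using h0)
  filter_upwards [h1] with x hx
  by_contra h
  exact hx (hs h)

end Components

/-! ### From coefficient bounds to bounds on, and constructions of, trial functions. -/

section Coefficients

variable {n m : ℕ}

/-- The quadratic form of `C` is equivalent to that of the model coefficients. -/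
def HasGrushinBounds (δ₁ δ₂ δ₁' δ₂' : ℝ)
    (C : RnRm n m → Matrix (Fin n ⊕ Fin m) (Fin n ⊕ Fin m) ℝ) : Prop :=
  ∃ b b' : ℝ, 0 < b ∧ 0 < b' ∧ ∀ᵐ x, ∀ v : Fin n ⊕ Fin m → ℝ,
    b * (twoPow ‖comp₁ x‖ δ₁ δ₁' ^ 2 * ∑ i, v (Sum.inl i) ^ 2 +
      twoPow ‖comp₁ x‖ δ₂ δ₂' ^ 2 * ∑ j, v (Sum.inr j) ^ 2) ≤
        ∑ i, ∑ j, C x i j * v i * v j ∧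
    ∑ i, ∑ j, C x i j * v i * v j ≤
      b' * (twoPow ‖comp₁ x‖ δ₁ δ₁' ^ 2 * ∑ i, v (Sum.inl i) ^ 2 +
        twoPow ‖comp₁ x‖ δ₂ δ₂' ^ 2 * ∑ j, v (Sum.inr j) ^ 2)

lemma sum_blockCoeff (c₁ c₂ : EuclideanSpace ℝ (Fin n) → ℝ) (x : RnRm n m)
    (v : Fin n ⊕ Fin m → ℝ) :
    ∑ i, ∑ j, blockCoeff c₁ c₂ x i j * v i * v j =
      c₁ (comp₁ x) * ∑ i, v (Sum.inl i) ^ 2 + c₂ (comp₁ x) * ∑ j, v (Sum.inr j) ^ 2 := by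
  simp [blockCoeff, Matrix.one_apply, Finset.mul_sum, sq, mul_assoc]

lemma sum_nonneg_of_posSemidef {ι : Type*} [Fintype ι] {A : Matrix ι ι ℝ} (hA : A.PosSemidef)
    (v : ι → ℝ) : 0 ≤ ∑ i, ∑ j, A i j * v i * v j := by
  have h := hA.dotProduct_mulVec_nonneg v
  simp only [dotProduct, Matrix.mulVec, Finset.mul_sum, star_trivial] at h
  refine h.trans_eq (Finset.sum_congr rfl fun i _ => Finset.sum_congr rfl fun j _ => by
    change v i * (A i j * v j) = A i j * v i * v j; ring)

lemma hasGrushinBounds_of_coeffEquiv {δ₁ δ₂ δ₁' δ₂' : ℝ}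
    {c₁ c₂ : EuclideanSpace ℝ (Fin n) → ℝ}
    (hc₁ : IsGrushinCoeff δ₁ δ₁' c₁) (hc₂ : IsGrushinCoeff δ₂ δ₂' c₂)
    {C : RnRm n m → Matrix (Fin n ⊕ Fin m) (Fin n ⊕ Fin m) ℝ}
    (hC : CoeffEquiv C (blockCoeff c₁ c₂)) : HasGrushinBounds δ₁ δ₂ δ₁' δ₂' C := by
  obtain ⟨-, a₁, a₁', ha₁, ha₁', h₁⟩ := hc₁
  obtain ⟨-, a₂, a₂', ha₂, ha₂', h₂⟩ := hc₂
  obtain ⟨a, a', ha, ha', h⟩ := hC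
  refine ⟨a * min a₁ a₂, a' * max a₁' a₂', by positivity, by positivity, ?_⟩
  filter_upwards [ae_comp₁ h₁, ae_comp₁ h₂, h] with x hx₁ hx₂ hx v
  have e1 := sum_nonneg_of_posSemidef hx.1 v
  have e2 := sum_nonneg_of_posSemidef hx.2 v
  simp only [Matrix.sub_apply, Matrix.smul_apply, smul_eq_mul, sub_mul, Finset.sum_sub_distrib,
    mul_assoc, ← Finset.mul_sum] at e1 e2
  have e3 := sum_blockCoeff c₁ c₂ x v
  simp only [mul_assoc] at e3 ⊢
  rw [e3] at e1 e2
  rw [twoPow_two_mul (norm_nonneg _)] at hx₁ hx₂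
  have q1 : 0 ≤ ∑ i, v (Sum.inl i) ^ 2 := Finset.sum_nonneg fun _ _ => sq_nonneg _
  have q2 : 0 ≤ ∑ i, v (Sum.inr i) ^ 2 := Finset.sum_nonneg fun _ _ => sq_nonneg _
  set Q₁ := ∑ i, v (Sum.inl i) ^ 2
  set Q₂ := ∑ i, v (Sum.inr i) ^ 2
  set P₁ := twoPow ‖comp₁ x‖ δ₁ δ₁' ^ 2
  set P₂ := twoPow ‖comp₁ x‖ δ₂ δ₂' ^ 2
  have p1 : 0 ≤ P₁ := sq_nonneg _
  have p2 : 0 ≤ P₂ := sq_nonneg _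
  constructor
  · have f1 : min a₁ a₂ * (P₁ * Q₁ + P₂ * Q₂) ≤ c₁ (comp₁ x) * Q₁ + c₂ (comp₁ x) * Q₂ := by
      calc _ = (min a₁ a₂ * P₁) * Q₁ + (min a₁ a₂ * P₂) * Q₂ := by ring
        _ ≤ (a₁ * P₁) * Q₁ + (a₂ * P₂) * Q₂ := by
          gcongr
          · exact min_le_left _ _
          · exact min_le_right _ _
        _ ≤ _ := by gcongr; exacts [hx₁.1, hx₂.1]
    nlinarith [mul_le_mul_of_nonneg_left f1 ha.le]
  · have f1 : c₁ (comp₁ x) * Q₁ + c₂ (comp₁ x) * Q₂ ≤ max a₁' a₂' * (P₁ * Q₁ + P₂ * Q₂) := by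
      calc _ ≤ (a₁' * P₁) * Q₁ + (a₂' * P₂) * Q₂ := by gcongr; exacts [hx₁.2, hx₂.2]
        _ ≤ (max a₁' a₂' * P₁) * Q₁ + (max a₁' a₂' * P₂) * Q₂ := by
          gcongr
          · exact le_max_left _ _
          · exact le_max_right _ _
        _ = _ := by ring
    nlinarith [mul_le_mul_of_nonneg_left f1 ha'.le]

variable {δ₁ δ₂ δ₁' δ₂' : ℝ} {C : RnRm n m → Matrix (Fin n ⊕ Fin m) (Fin n ⊕ Fin m) ℝ}

/-- Trial functions are Lipschitz away from the degeneracy, anisotropically. -/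
lemma trialFunctions_abs_sub_le (hδ₁ : 0 ≤ δ₁) (hδ₁' : 0 ≤ δ₁') (hδ₂ : 0 ≤ δ₂) (hδ₂' : 0 ≤ δ₂')
    (hC : HasGrushinBounds δ₁ δ₂ δ₁' δ₂' C) :
    ∃ K : ℝ, 0 ≤ K ∧ ∀ ψ ∈ trialFunctions C, ∀ (y z : RnRm n m) (r : ℝ), 0 < r →
      (∀ τ ∈ Set.Icc (0 : ℝ) 1, 2 * r ≤ ‖comp₁ z + τ • (comp₁ y - comp₁ z)‖) →
      |ψ y - ψ z| ≤ K * (‖comp₁ y - comp₁ z‖ / twoPow r δ₁ δ₁' +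
        ‖comp₂ y - comp₂ z‖ / twoPow r δ₂ δ₂') := by
  obtain ⟨b, _, hb, _, hC⟩ := hC
  refine ⟨(n + m) * (√b)⁻¹, by positivity, ?_⟩
  rintro ψ ⟨g, hψ, hg⟩ y z r hr hyz
  have hP₁ : 0 < twoPow r δ₁ δ₁' := twoPow_pos hr
  have hP₂ : 0 < twoPow r δ₂ δ₂' := twoPow_pos hr
  refine abs_sub_le_of_isW1Infty hψ y z hr ?_
  filter_upwards [hC, hg] with x hx hgx
  rintro ⟨τ, hτ, hd⟩
  -- The segment stays at distance `2r` from `x₁ = 0`, so its tube of radius `r` stays at distance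
  -- `r`. There the coefficients are bounded below by their values at scale `r`.
  have hrx : r ≤ ‖comp₁ x‖ := by
    have h1 : ‖comp₁ x - (comp₁ z + τ • (comp₁ y - comp₁ z))‖ < r := by
      rw [dist_eq_norm] at hd
      exact (norm_comp₁_le (x - (z + τ • (y - z)))).trans_lt hd
    have h2 := norm_sub_norm_le (comp₁ z + τ • (comp₁ y - comp₁ z)) (comp₁ x)
    rw [norm_sub_rev] at h2
    linarith [hyz τ hτ]
  have hle := ((hx (fun i => g i x)).1).trans hgx
  have hs1 : 0 ≤ ∑ i, g (Sum.inl i) x ^ 2 := Finset.sum_nonneg fun _ _ => sq_nonneg _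
  have hs2 : 0 ≤ ∑ j, g (Sum.inr j) x ^ 2 := Finset.sum_nonneg fun _ _ => sq_nonneg _
  have hcomp : ∀ p P G Q : ℝ, 0 < p → p ≤ P → G ^ 2 ≤ Q → b * (P ^ 2 * Q) ≤ 1 →
      |G| ≤ (√b)⁻¹ / p := by
    intro p P G Q hp hpP hGQ hbd
    have h1 : b * (p ^ 2 * G ^ 2) ≤ 1 := by
      refine le_trans ?_ hbd
      have : p ^ 2 ≤ P ^ 2 := pow_le_pow_left₀ hp.le hpP 2
      gcongr
    rw [le_div_iff₀ hp, ← one_div, le_div_iff₀ (Real.sqrt_pos.2 hb)]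
    refine abs_le_of_sq_le_sq' (a := |G| * p * √b) ?_ zero_le_one |>.2
    rw [mul_pow, mul_pow, sq_abs, Real.sq_sqrt hb.le]; linarith
  have hg1 : ∀ i, |g (Sum.inl i) x| ≤ (√b)⁻¹ / twoPow r δ₁ δ₁' := fun i =>
    hcomp _ (twoPow ‖comp₁ x‖ δ₁ δ₁') _ (∑ i, g (Sum.inl i) x ^ 2) hP₁
      (twoPow_mono hr.le hrx hδ₁ hδ₁')
      (Finset.single_le_sum (f := fun i => g (Sum.inl i) x ^ 2) (fun _ _ => sq_nonneg _)
        (Finset.mem_univ i)) (by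
        refine le_trans ?_ hle
        gcongr
        exact le_add_of_nonneg_right (by positivity))
  have hg2 : ∀ j, |g (Sum.inr j) x| ≤ (√b)⁻¹ / twoPow r δ₂ δ₂' := fun j =>
    hcomp _ (twoPow ‖comp₁ x‖ δ₂ δ₂') _ (∑ j, g (Sum.inr j) x ^ 2) hP₂
      (twoPow_mono hr.le hrx hδ₂ hδ₂')
      (Finset.single_le_sum (f := fun i => g (Sum.inr i) x ^ 2) (fun _ _ => sq_nonneg _)
        (Finset.mem_univ j)) (by
        refine le_trans ?_ hle
        gcongr
        exact le_add_of_nonneg_left (by positivity))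
  rw [Fintype.sum_sum_type]
  have t1 : |∑ i, (y (Sum.inl i) - z (Sum.inl i)) * g (Sum.inl i) x| ≤
      n * (‖comp₁ y - comp₁ z‖ * ((√b)⁻¹ / twoPow r δ₁ δ₁')) := by
    refine (Finset.abs_sum_le_sum_abs _ _).trans ?_
    refine (Finset.sum_le_card_nsmul _ _ (‖comp₁ y - comp₁ z‖ * ((√b)⁻¹ / twoPow r δ₁ δ₁'))
      fun i _ => ?_).trans_eq (by simp)
    rw [abs_mul]
    exact mul_le_mul (abs_apply_le_norm (comp₁ y - comp₁ z) i) (hg1 i) (abs_nonneg _)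
      (norm_nonneg _)
  have t2 : |∑ i, (y (Sum.inr i) - z (Sum.inr i)) * g (Sum.inr i) x| ≤
      m * (‖comp₂ y - comp₂ z‖ * ((√b)⁻¹ / twoPow r δ₂ δ₂')) := by
    refine (Finset.abs_sum_le_sum_abs _ _).trans ?_
    refine (Finset.sum_le_card_nsmul _ _ (‖comp₂ y - comp₂ z‖ * ((√b)⁻¹ / twoPow r δ₂ δ₂'))
      fun i _ => ?_).trans_eq (by simp)
    rw [abs_mul]
    exact mul_le_mul (abs_apply_le_norm (comp₂ y - comp₂ z) i) (hg2 i) (abs_nonneg _)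
      (norm_nonneg _)
  refine (abs_add_le _ _).trans ((add_le_add t1 t2).trans ?_)
  have u1 : 0 ≤ ‖comp₁ y - comp₁ z‖ / twoPow r δ₁ δ₁' * (√b)⁻¹ := by positivity
  have u2 : 0 ≤ ‖comp₂ y - comp₂ z‖ / twoPow r δ₂ δ₂' * (√b)⁻¹ := by positivity
  have v1 : 0 ≤ (m : ℝ) * (‖comp₁ y - comp₁ z‖ / twoPow r δ₁ δ₁' * (√b)⁻¹) := by positivity
  have v2 : 0 ≤ (n : ℝ) * (‖comp₂ y - comp₂ z‖ / twoPow r δ₂ δ₂' * (√b)⁻¹) := by positivity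
  calc _ = n * (‖comp₁ y - comp₁ z‖ / twoPow r δ₁ δ₁' * (√b)⁻¹) +
        m * (‖comp₂ y - comp₂ z‖ / twoPow r δ₂ δ₂' * (√b)⁻¹) := by ring
    _ ≤ _ := by linarith

/-- Bounded functions with the right anisotropic Lipschitz constants at scale `R` which are constant
beyond `R` are trial functions, up to a factor. -/
lemma exists_smul_mem_trialFunctions (hδ₁ : 0 ≤ δ₁) (hδ₁' : 0 ≤ δ₁') (hδ₂ : 0 ≤ δ₂)
    (hδ₂' : 0 ≤ δ₂') (hC : HasGrushinBounds δ₁ δ₂ δ₁' δ₂' C) :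
    ∃ κ : ℝ, 0 < κ ∧ ∀ (R : ℝ) (ψ : RnRm n m → ℝ) (b c : ℝ), 0 < R → (∀ x, |ψ x| ≤ b) →
      (∀ x y, |ψ x - ψ y| ≤ ‖comp₁ x - comp₁ y‖ / twoPow R δ₁ δ₁' +
        ‖comp₂ x - comp₂ y‖ / twoPow R δ₂ δ₂') →
      (∀ x, R < ‖comp₁ x‖ → ψ x = c) → (fun x => κ * ψ x) ∈ trialFunctions C := by
  obtain ⟨_, b', _, hb', hC⟩ := hC
  -- Each scaled partial derivative contributes at most `κ²`, so the form is at most `b' (n + m) κ²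
  -- ≤ N κ² = 1`. The summand `1` keeps `N` positive when `n = m = 0`.
  set N : ℝ := b' * (n + m) + 1 with hN
  have hN0 : 0 < N := by positivity
  refine ⟨(√N)⁻¹, by positivity, ?_⟩
  intro R ψ b c hR hb hL hc
  set κ := (√N)⁻¹ with hκ
  have hκ0 : 0 < κ := by positivity
  have hκ2 : N * κ ^ 2 = 1 := by
    rw [hκ, inv_pow, Real.sq_sqrt hN0.le]; field_simp
  have hP₁ : 0 < twoPow R δ₁ δ₁' := twoPow_pos hR
  have hP₂ : 0 < twoPow R δ₂ δ₂' := twoPow_pos hR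
  set L₁ := κ / twoPow R δ₁ δ₁' with hL₁
  set L₂ := κ / twoPow R δ₂ δ₂' with hL₂
  have hL₁0 : 0 < L₁ := by positivity
  have hL₂0 : 0 < L₂ := by positivity
  have hL' : ∀ x y, |κ * ψ x - κ * ψ y| ≤ L₁ * ‖comp₁ x - comp₁ y‖ +
      L₂ * ‖comp₂ x - comp₂ y‖ := fun x y => by
    rw [← mul_sub, abs_mul, abs_of_pos hκ0]
    refine (mul_le_mul_of_nonneg_left (hL x y) hκ0.le).trans_eq ?_
    rw [hL₁, hL₂]; ring
  have hLip : LipschitzWith (L₁ + L₂).toNNReal (fun x => κ * ψ x) := by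
    refine LipschitzWith.of_dist_le_mul fun x y => ?_
    rw [Real.dist_eq, Real.coe_toNNReal _ (by positivity), dist_eq_norm]
    refine (hL' x y).trans ?_
    have h1 := norm_comp₁_le (x - y)
    have h2 := norm_comp₂_le (x - y)
    rw [comp₁_sub] at h1
    rw [comp₂_sub] at h2
    rw [add_mul]; gcongr
  refine ⟨_, isW1Infty_of_lipschitzWith hLip (b := κ * b) fun x => ?_, ?_⟩
  · rw [abs_mul, abs_of_pos hκ0]; exact mul_le_mul_of_nonneg_left (hb x) hκ0.le
  have hd1 : ∀ x i, |lineDeriv ℝ (fun x => κ * ψ x) x (EuclideanSpace.single (Sum.inl i) 1)| ≤ L₁ :=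
    fun x i => abs_lineDeriv_le fun t => by
      refine (hL' _ _).trans ?_
      rw [← comp₁_sub, ← comp₂_sub, add_sub_cancel_left, comp₁_smul, comp₂_smul]
      have e1 : comp₁ (EuclideanSpace.single (Sum.inl i) 1 : RnRm n m) =
          EuclideanSpace.single i 1 := by
        ext j; simp [comp₁]
      have e2 : comp₂ (EuclideanSpace.single (Sum.inl i) 1 : RnRm n m) = 0 := by
        ext j; simp [comp₂]
      simp [e1, e2, norm_smul]
  have hd2 : ∀ x i, |lineDeriv ℝ (fun x => κ * ψ x) x (EuclideanSpace.single (Sum.inr i) 1)| ≤ L₂ :=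
    fun x i => abs_lineDeriv_le fun t => by
      refine (hL' _ _).trans ?_
      rw [← comp₁_sub, ← comp₂_sub, add_sub_cancel_left, comp₁_smul, comp₂_smul]
      have e1 : comp₂ (EuclideanSpace.single (Sum.inr i) 1 : RnRm n m) =
          EuclideanSpace.single i 1 := by
        ext j; simp [comp₂]
      have e2 : comp₁ (EuclideanSpace.single (Sum.inr i) 1 : RnRm n m) = 0 := by
        ext j; simp [comp₁]
      simp [e1, e2, norm_smul]
  filter_upwards [hC] with x hx
  by_cases hxR : R < ‖comp₁ x‖
  · have h0 : ∀ v, lineDeriv ℝ (fun x => κ * ψ x) x v = 0 := by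
      refine lineDeriv_eq_zero_of_eventually (c := κ * c) ?_
      have : {y : RnRm n m | R < ‖comp₁ y‖} ∈ nhds x :=
        (isOpen_lt continuous_const continuous_comp₁.norm).mem_nhds hxR
      filter_upwards [this] with y hy
      rw [hc y hy]
    simp [h0]
  · push Not at hxR
    refine (hx _).2.trans ?_
    have q1 : twoPow ‖comp₁ x‖ δ₁ δ₁' ^ 2 * ∑ i, lineDeriv ℝ (fun x => κ * ψ x) x
        (EuclideanSpace.single (Sum.inl i) 1) ^ 2 ≤ n * κ ^ 2 := by
      calc _ ≤ twoPow R δ₁ δ₁' ^ 2 * ∑ i : Fin n, L₁ ^ 2 := by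
            exact mul_le_mul (pow_le_pow_left₀ (twoPow_nonneg (norm_nonneg _))
              (twoPow_mono (norm_nonneg _) hxR hδ₁ hδ₁') 2)
              (Finset.sum_le_sum fun i _ =>
                sq_le_sq' (abs_le.1 (hd1 x i)).1 (abs_le.1 (hd1 x i)).2)
              (Finset.sum_nonneg fun _ _ => sq_nonneg _) (sq_nonneg _)
        _ = _ := by rw [hL₁]; simp; field_simp
    have q2 : twoPow ‖comp₁ x‖ δ₂ δ₂' ^ 2 * ∑ i, lineDeriv ℝ (fun x => κ * ψ x) x
        (EuclideanSpace.single (Sum.inr i) 1) ^ 2 ≤ m * κ ^ 2 := by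
      calc _ ≤ twoPow R δ₂ δ₂' ^ 2 * ∑ i : Fin m, L₂ ^ 2 := by
            exact mul_le_mul (pow_le_pow_left₀ (twoPow_nonneg (norm_nonneg _))
              (twoPow_mono (norm_nonneg _) hxR hδ₂ hδ₂') 2)
              (Finset.sum_le_sum fun i _ =>
                sq_le_sq' (abs_le.1 (hd2 x i)).1 (abs_le.1 (hd2 x i)).2)
              (Finset.sum_nonneg fun _ _ => sq_nonneg _) (sq_nonneg _)
        _ = _ := by rw [hL₂]; simp; field_simp
    calc _ ≤ b' * (n * κ ^ 2 + m * κ ^ 2) := by gcongr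
      _ ≤ N * κ ^ 2 := by rw [hN]; nlinarith [sq_nonneg κ]
      _ = 1 := hκ2

end Coefficients

/-! ### Increments of segment-Lipschitz functions are controlled by `D_δ`. -/

section Grushin

variable {n m : ℕ} {δ₁ δ₂ δ₁' δ₂' : ℝ}

/-- The scale at which the increment `x₂ - y₂` is travelled. -/
noncomputable def grushinScale (δ₁ δ₂ δ₁' δ₂' : ℝ) (x y : RnRm n m) : ℝ :=
  max (‖comp₁ x‖ + ‖comp₁ y‖)
    (twoPow ‖comp₂ x - comp₂ y‖ (1 + δ₂ - δ₁)⁻¹ (1 + δ₂' - δ₁')⁻¹)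

lemma grushinScale_nonneg (x y : RnRm n m) : 0 ≤ grushinScale δ₁ δ₂ δ₁' δ₂' x y :=
  le_max_of_le_left (by positivity)

/-- The case distinction asks which entry of the maximum in `grushinScale` is larger, since powers
with positive exponents are increasing. In the second case `1 - γ = 1 - δ₂/ρ` turns the power of `t`
into the same quotient. Both cases can then be treated at once. -/
lemma grushinΔ_eq (hδ₁ : δ₁ < 1) (hδ₁' : δ₁' < 1) (hδ₂ : 0 ≤ δ₂) (hδ₂' : 0 ≤ δ₂')
    (x y : RnRm n m) :
    grushinΔ δ₁ δ₂ δ₁' δ₂' x y =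
      ‖comp₂ x - comp₂ y‖ / twoPow (grushinScale δ₁ δ₂ δ₁' δ₂' x y) δ₂ δ₂' := by
  have hρ : 0 < 1 + δ₂ - δ₁ := by linarith
  have hρ' : 0 < 1 + δ₂' - δ₁' := by linarith
  unfold grushinΔ grushinScale
  dsimp only
  set s := ‖comp₁ x‖ + ‖comp₁ y‖
  have hs : 0 ≤ s := by positivity
  set t := ‖comp₂ x - comp₂ y‖
  have ht : 0 ≤ t := norm_nonneg _
  have hT := twoPow_twoPow_inv ht hρ hρ'
  have hT0 : 0 ≤ twoPow t (1 + δ₂ - δ₁)⁻¹ (1 + δ₂' - δ₁')⁻¹ := twoPow_nonneg ht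
  split_ifs with h
  · rw [max_eq_left]
    have := twoPow_mono ht h (inv_pos.2 hρ).le (inv_pos.2 hρ').le
    rwa [twoPow_inv_twoPow hs hρ hρ'] at this
  · push Not at h
    have ht0 : 0 < t := (twoPow_nonneg hs).trans_lt h
    rw [max_eq_right, twoPow_twoPow ht (inv_pos.2 hρ) (inv_pos.2 hρ'),
      eq_div_iff (twoPow_pos ht0).ne', inv_mul_eq_div, inv_mul_eq_div, twoPow_one_sub_mul ht0]
    by_contra h'
    push Not at h'
    have := twoPow_mono hT0 h'.le hρ.le hρ'.le
    rw [hT] at this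
    linarith

lemma grushinΔ_nonneg (x y : RnRm n m) : 0 ≤ grushinΔ δ₁ δ₂ δ₁' δ₂' x y := by
  unfold grushinΔ
  dsimp only
  split_ifs
  · exact div_nonneg (norm_nonneg _) (twoPow_nonneg (by positivity))
  · exact twoPow_nonneg (norm_nonneg _)

lemma norm_sub_div_twoPow_nonneg (a b : EuclideanSpace ℝ (Fin n)) (δ δ' : ℝ) :
    0 ≤ ‖a - b‖ / twoPow (‖a‖ + ‖b‖) δ δ' :=
  div_nonneg (norm_nonneg _) (twoPow_nonneg (by positivity))

/-- Keeps a segment shorter than its larger endpoint norm away from the degeneracy, as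
`IsSegmentLipschitz` requires. -/
lemma norm_le_of_le_segment {E : Type*} [NormedAddCommGroup E] [NormedSpace ℝ E] (a b : E)
    {τ : ℝ} (hτ : τ ∈ Set.Icc (0 : ℝ) 1) :
    max ‖a‖ ‖b‖ - ‖a - b‖ ≤ ‖b + τ • (a - b)‖ := by
  have h0 : 0 ≤ ‖a - b‖ := norm_nonneg _
  rw [sub_le_iff_le_add, max_le_iff]
  constructor
  · have : a = (b + τ • (a - b)) + (1 - τ) • (a - b) := by module
    calc ‖a‖ = ‖(b + τ • (a - b)) + (1 - τ) • (a - b)‖ := by rw [← this]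
      _ ≤ _ := norm_add_le _ _
      _ ≤ _ := by
        rw [norm_smul, Real.norm_of_nonneg (by linarith [hτ.2])]
        nlinarith [hτ.1]
  · have : b = (b + τ • (a - b)) - τ • (a - b) := by module
    calc ‖b‖ = ‖(b + τ • (a - b)) - τ • (a - b)‖ := by rw [← this]
      _ ≤ _ := norm_sub_le _ _
      _ ≤ _ := by
        rw [norm_smul, Real.norm_of_nonneg hτ.1]
        nlinarith [hτ.2]

/-- The anisotropic Lipschitz condition with constant `K` along segments which stay at distance
`2r` from the degeneracy. -/
def IsSegmentLipschitz (δ₁ δ₂ δ₁' δ₂' K : ℝ) (h : RnRm n m → ℝ) : Prop :=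
  ∀ (y z : RnRm n m) (r : ℝ), 0 < r →
    (∀ τ ∈ Set.Icc (0 : ℝ) 1, 2 * r ≤ ‖comp₁ z + τ • (comp₁ y - comp₁ z)‖) →
    |h y - h z| ≤ K * (‖comp₁ y - comp₁ z‖ / twoPow r δ₁ δ₁' +
      ‖comp₂ y - comp₂ z‖ / twoPow r δ₂ δ₂')

lemma div_twoPow_div_le {t a l α α' : ℝ} (ht : 0 ≤ t) (ha : 0 < a) (hl : 1 ≤ l) (hα : 0 ≤ α)
    (hα' : 0 ≤ α') : t / twoPow a α α' ≤ l ^ (α + α') * (t / twoPow (l * a) α α') := by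
  have hl0 : 0 < l := by linarith
  have h1 : 0 < twoPow a α α' := twoPow_pos ha
  have h2 : 0 < twoPow (l * a) α α' := twoPow_pos (by positivity)
  rw [← mul_div_assoc, div_le_div_iff₀ h1 h2]
  calc t * twoPow (l * a) α α' ≤ t * (l ^ (α + α') * twoPow a α α') := by
        gcongr; exact twoPow_dilate_le hl ha.le hα hα'
    _ = _ := by ring

/-- Chain through the points `2⁻ᵏ a`. The `k`-th step has length comparable to its distance from
`0`, hence costs a multiple of `(2⁻ᵏ|a|)^(1-δ₁,1-δ₁')`. As `δ₁, δ₁' < 1` these costs sum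
geometrically, and continuity of `h` supplies the limit at `0`. -/
lemma IsSegmentLipschitz.abs_sub_zero_le (hδ₁_lt : δ₁ < 1) (hδ₁'_lt : δ₁' < 1)
    {K : ℝ} (hK : 0 ≤ K) :
    ∃ K₁ : ℝ, 0 ≤ K₁ ∧ ∀ h : RnRm n m → ℝ, Continuous h → IsSegmentLipschitz δ₁ δ₂ δ₁' δ₂' K h →
      ∀ (a : EuclideanSpace ℝ (Fin n)) (w : EuclideanSpace ℝ (Fin m)),
        |h (joinComp a w) - h (joinComp 0 w)| ≤ K₁ * twoPow ‖a‖ (1 - δ₁) (1 - δ₁') := by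
  set θ := min (1 - δ₁) (1 - δ₁') with hθ
  have hθ0 : 0 < θ := lt_min (by linarith) (by linarith)
  set q : ℝ := (1 / 2 : ℝ) ^ θ with hq
  have hq1 : q < 1 := Real.rpow_lt_one (by norm_num) (by norm_num) hθ0
  have hq0 : 0 < q := by positivity
  refine ⟨2 * K / (1 - q), div_nonneg (by linarith) (by linarith), fun h hc hh a w => ?_⟩
  rcases eq_or_ne a 0 with rfl | ha
  · simp only [sub_self, abs_zero]
    exact mul_nonneg (div_nonneg (by linarith) (by linarith)) (twoPow_nonneg (norm_nonneg _))
  have ha0 : 0 < ‖a‖ := norm_pos_iff.2 ha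
  have hlim : Filter.Tendsto (fun k : ℕ => h (joinComp ((1 / 2 : ℝ) ^ k • a) w)) Filter.atTop
      (nhds (h (joinComp 0 w))) := by
    have h1 : Filter.Tendsto (fun k : ℕ => (1 / 2 : ℝ) ^ k • a) Filter.atTop (nhds 0) := by
      simpa using (tendsto_pow_atTop_nhds_zero_of_lt_one (r := (1 / 2 : ℝ)) (by norm_num)
        (by norm_num)).smul_const a
    have h2 : Continuous fun a => h (joinComp a w) :=
      hc.comp (continuous_joinComp.comp (continuous_id.prodMk continuous_const))
    exact (h2.tendsto 0).comp h1
  have := dist_le_of_le_geometric_of_tendsto₀ q (2 * K * twoPow ‖a‖ (1 - δ₁) (1 - δ₁')) hq1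
    (f := fun k : ℕ => h (joinComp ((1 / 2 : ℝ) ^ k • a) w)) (fun k => ?_) hlim
  · rw [Real.dist_eq] at this
    simp only [pow_zero, one_smul] at this
    exact this.trans_eq (by ring)
  -- The larger endpoint has norm `4r` and the step has length `2r`, which leaves exactly the
  -- distance `2r` required.
  set r := (1 / 2 : ℝ) ^ k * ‖a‖ / 4 with hr
  have hr0 : 0 < r := by positivity
  have hka : ‖(1 / 2 : ℝ) ^ k • a‖ = 4 * r := by
    rw [norm_smul, Real.norm_of_nonneg (by positivity), hr]; ring
  have hkd : (1 / 2 : ℝ) ^ k • a - (1 / 2 : ℝ) ^ (k + 1) • a = (1 / 2 : ℝ) • (1 / 2 : ℝ) ^ k • a := by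
    rw [pow_succ]; module
  have hkn : ‖(1 / 2 : ℝ) ^ k • a - (1 / 2 : ℝ) ^ (k + 1) • a‖ = 2 * r := by
    rw [hkd, norm_smul, hka]; norm_num; ring
  rw [Real.dist_eq]
  refine (hh _ _ r hr0 fun τ hτ => ?_).trans ?_
  · have := norm_le_of_le_segment ((1 / 2 : ℝ) ^ k • a) ((1 / 2 : ℝ) ^ (k + 1) • a) hτ
    rw [hkn, hka] at this
    simp only [comp₁_joinComp]
    linarith [le_max_left (4 * r) ‖(1 / 2 : ℝ) ^ (k + 1) • a‖]
  · simp only [comp₁_joinComp, comp₂_joinComp, sub_self, norm_zero, zero_div, add_zero, hkn]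
    have e1 : 2 * r / twoPow r δ₁ δ₁' = 2 * twoPow r (1 - δ₁) (1 - δ₁') := by
      rw [div_eq_iff (twoPow_pos hr0).ne', mul_assoc, twoPow_one_sub_mul hr0]
    have e2 : twoPow r (1 - δ₁) (1 - δ₁') ≤ q ^ k * twoPow ‖a‖ (1 - δ₁) (1 - δ₁') := by
      calc _ ≤ twoPow ((1 / 2 : ℝ) ^ k * ‖a‖) (1 - δ₁) (1 - δ₁') :=
            twoPow_mono hr0.le (by rw [hr]; linarith) (by linarith) (by linarith)
        _ ≤ ((1 / 2 : ℝ) ^ k) ^ θ * twoPow ‖a‖ (1 - δ₁) (1 - δ₁') :=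
            twoPow_contract_le (by positivity) (pow_le_one₀ (by norm_num) (by norm_num))
              ha0.le (min_le_left _ _) (min_le_right _ _)
        _ = _ := by
            rw [hq, ← Real.rpow_natCast, ← Real.rpow_mul (by norm_num), mul_comm (k : ℝ),
              Real.rpow_mul (by norm_num), Real.rpow_natCast]
    rw [e1]
    calc K * (2 * twoPow r (1 - δ₁) (1 - δ₁')) ≤
        K * (2 * (q ^ k * twoPow ‖a‖ (1 - δ₁) (1 - δ₁'))) := by gcongr
      _ = _ := by ring

/-- If `|a - b|` is small against `s = |a| + |b|`, the direct segment stays at distance comparable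
to `s` from `0`. Otherwise `|a - b| ∼ s`, and the detour through `0` costs a multiple of
`s^(1-δ₁,1-δ₁')`, which is comparable to the bound. -/
lemma IsSegmentLipschitz.abs_sub_comp₁_le (hδ₁ : 0 ≤ δ₁) (hδ₁' : 0 ≤ δ₁') (hδ₁_lt : δ₁ < 1)
    (hδ₁'_lt : δ₁' < 1) {K : ℝ} (hK : 0 ≤ K) :
    ∃ K₁ : ℝ, 0 ≤ K₁ ∧ ∀ h : RnRm n m → ℝ, Continuous h → IsSegmentLipschitz δ₁ δ₂ δ₁' δ₂' K h →
      ∀ (a b : EuclideanSpace ℝ (Fin n)) (w : EuclideanSpace ℝ (Fin m)),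
        |h (joinComp a w) - h (joinComp b w)| ≤
          K₁ * (‖a - b‖ / twoPow (‖a‖ + ‖b‖) δ₁ δ₁') := by
  obtain ⟨K₁, hK₁, hr⟩ := IsSegmentLipschitz.abs_sub_zero_le (n := n) (m := m) (δ₂ := δ₂)
    (δ₂' := δ₂') hδ₁_lt hδ₁'_lt hK
  refine ⟨K * 8 ^ (δ₁ + δ₁') + 8 * K₁, by positivity, fun h hc hh a b w => ?_⟩
  have hD := norm_sub_div_twoPow_nonneg a b δ₁ δ₁'
  rcases eq_or_ne a b with rfl | hab
  · simp
  have hs : 0 < ‖a‖ + ‖b‖ := by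
    have := norm_pos_iff.2 (sub_ne_zero.2 hab)
    exact this.trans_le (norm_sub_le _ _)
  set s := ‖a‖ + ‖b‖ with hs'
  have hp : 0 < twoPow s δ₁ δ₁' := twoPow_pos hs
  by_cases hclose : ‖a - b‖ < s / 4
  · have h1 := hh (joinComp a w) (joinComp b w) (s / 8) (by positivity) fun τ hτ => by
      have h2 := norm_le_of_le_segment a b hτ
      have h3 : s / 2 ≤ max ‖a‖ ‖b‖ := by
        rcases le_total ‖a‖ ‖b‖ with h | h
        · exact le_max_of_le_right (by linarith)
        · exact le_max_of_le_left (by linarith)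
      simp only [comp₁_joinComp]
      linarith
    simp only [comp₁_joinComp, comp₂_joinComp, sub_self, norm_zero, zero_div, add_zero] at h1
    have h2 := div_twoPow_div_le (norm_nonneg (a - b)) (a := s / 8) (l := 8) (by positivity)
      (by norm_num) hδ₁ hδ₁'
    rw [mul_div_cancel₀ _ (by norm_num : (8 : ℝ) ≠ 0)] at h2
    have h3 := mul_le_mul_of_nonneg_left h2 hK
    have h4 := mul_nonneg hK₁ hD
    nlinarith
  · push Not at hclose
    have h1 := hr h hc hh a w
    have h2 := hr h hc hh b w
    have h3 : twoPow ‖a‖ (1 - δ₁) (1 - δ₁') ≤ twoPow s (1 - δ₁) (1 - δ₁') :=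
      twoPow_mono (norm_nonneg _) (le_add_of_nonneg_right (norm_nonneg _)) (by linarith)
        (by linarith)
    have h4 : twoPow ‖b‖ (1 - δ₁) (1 - δ₁') ≤ twoPow s (1 - δ₁) (1 - δ₁') :=
      twoPow_mono (norm_nonneg _) (le_add_of_nonneg_left (norm_nonneg _)) (by linarith)
        (by linarith)
    have h5 : twoPow s (1 - δ₁) (1 - δ₁') ≤ 4 * (‖a - b‖ / twoPow s δ₁ δ₁') := by
      rw [← mul_div_assoc, le_div_iff₀ hp, twoPow_one_sub_mul hs]; linarith
    have h6 := abs_sub_le (h (joinComp a w)) (h (joinComp 0 w)) (h (joinComp b w))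
    rw [abs_sub_comm (h (joinComp 0 w))] at h6
    have h7 := mul_le_mul_of_nonneg_left (h3.trans h5) hK₁
    have h8 := mul_le_mul_of_nonneg_left (h4.trans h5) hK₁
    have h9 : 0 ≤ K * 8 ^ (δ₁ + δ₁') * (‖a - b‖ / twoPow s δ₁ δ₁') := by positivity
    nlinarith

lemma IsSegmentLipschitz.abs_sub_comp₂_le (hδ₂ : 0 ≤ δ₂) (hδ₂' : 0 ≤ δ₂') {K : ℝ} (hK : 0 ≤ K)
    {h : RnRm n m → ℝ} (hh : IsSegmentLipschitz δ₁ δ₂ δ₁' δ₂' K h)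
    (a : EuclideanSpace ℝ (Fin n)) (w w' : EuclideanSpace ℝ (Fin m)) {S : ℝ} (hS : 0 < S)
    (haS : S ≤ 2 * ‖a‖) :
    |h (joinComp a w) - h (joinComp a w')| ≤
      K * 4 ^ (δ₂ + δ₂') * (‖w - w'‖ / twoPow S δ₂ δ₂') := by
  have h1 := hh (joinComp a w) (joinComp a w') (S / 4) (by positivity) fun τ _ => by
    simp only [comp₁_joinComp, sub_self, smul_zero, add_zero]
    linarith
  simp only [comp₁_joinComp, comp₂_joinComp, sub_self, norm_zero, zero_div, zero_add] at h1
  have h2 := div_twoPow_div_le (norm_nonneg (w - w')) (a := S / 4) (l := 4) (by positivity)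
    (by norm_num) hδ₂ hδ₂'
  rw [mul_div_cancel₀ _ (by norm_num : (4 : ℝ) ≠ 0)] at h2
  calc _ ≤ _ := h1
    _ ≤ _ := mul_le_mul_of_nonneg_left h2 hK
    _ = _ := by ring

/-- If the scale is `s = |a| + |b|`, move `x₂` at whichever of `a`, `b` has the larger norm.
Otherwise `x₂` must be moved farther out, at a point `e` with `|e| = T`. -/
lemma IsSegmentLipschitz.abs_sub_le_grushinD (hn : 1 ≤ n) (hδ₁ : 0 ≤ δ₁) (hδ₁' : 0 ≤ δ₁')
    (hδ₁_lt : δ₁ < 1) (hδ₁'_lt : δ₁' < 1) (hδ₂ : 0 ≤ δ₂) (hδ₂' : 0 ≤ δ₂') {K : ℝ} (hK : 0 ≤ K) :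
    ∃ K₁ : ℝ, 0 ≤ K₁ ∧ ∀ h : RnRm n m → ℝ, Continuous h → IsSegmentLipschitz δ₁ δ₂ δ₁' δ₂' K h →
      ∀ x y : RnRm n m, |h x - h y| ≤ K₁ * grushinD δ₁ δ₂ δ₁' δ₂' x y := by
  obtain ⟨K₁, hK₁, hr⟩ := IsSegmentLipschitz.abs_sub_comp₁_le (n := n) (m := m) (δ₂ := δ₂)
    (δ₂' := δ₂') hδ₁ hδ₁' hδ₁_lt hδ₁'_lt hK
  refine ⟨K₁ + 2 * K₁ * 2 ^ (1 - δ₁ + (1 - δ₁')) + K * 4 ^ (δ₂ + δ₂'), by positivity,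
    fun h hc hh x y => ?_⟩
  have hρ : 0 < 1 + δ₂ - δ₁ := by linarith
  have hρ' : 0 < 1 + δ₂' - δ₁' := by linarith
  have hD := norm_sub_div_twoPow_nonneg (comp₁ x) (comp₁ y) δ₁ δ₁'
  have hΔ := grushinΔ_nonneg (δ₁ := δ₁) (δ₂ := δ₂) (δ₁' := δ₁') (δ₂' := δ₂') x y
  have hK₂ : 0 ≤ 2 * K₁ * 2 ^ (1 - δ₁ + (1 - δ₁')) := by positivity
  have hK₃ : 0 ≤ K * 4 ^ (δ₂ + δ₂') := by positivity
  unfold grushinD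
  have hΔe := grushinΔ_eq hδ₁_lt hδ₁'_lt hδ₂ hδ₂' x y
  unfold grushinScale at hΔe
  obtain ⟨a, w, rfl⟩ : ∃ a w, x = joinComp a w := ⟨_, _, (joinComp_comp x).symm⟩
  obtain ⟨b, w', rfl⟩ : ∃ a w, y = joinComp a w := ⟨_, _, (joinComp_comp y).symm⟩
  simp only [comp₁_joinComp, comp₂_joinComp] at hD hΔe ⊢
  set Δ := grushinΔ δ₁ δ₂ δ₁' δ₂' (joinComp a w) (joinComp b w')
  set s := ‖a‖ + ‖b‖ with hs
  have hs0 : 0 ≤ s := by positivity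
  have ht : 0 ≤ ‖w - w'‖ := norm_nonneg _
  set T := twoPow ‖w - w'‖ (1 + δ₂ - δ₁)⁻¹ (1 + δ₂' - δ₁')⁻¹ with hT
  have hT0 : 0 ≤ T := twoPow_nonneg ht
  have hTt : twoPow T (1 + δ₂ - δ₁) (1 + δ₂' - δ₁') = ‖w - w'‖ := twoPow_twoPow_inv ht hρ hρ'
  set d := ‖a - b‖ / twoPow s δ₁ δ₁'
  set A := 2 * K₁ * 2 ^ (1 - δ₁ + (1 - δ₁')) with hA
  set B := K * 4 ^ (δ₂ + δ₂')
  have n1 := mul_nonneg hK₁ hΔ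
  have n2 := mul_nonneg hK₂ hΔ
  have n3 := mul_nonneg hK₂ hD
  have n4 := mul_nonneg hK₃ hD
  by_cases hTs : T ≤ s
  · rw [max_eq_left hTs] at hΔe
    -- When `s = 0` also `T = 0`, so the two points coincide.
    rcases hs0.eq_or_lt with h0 | hs1
    · have ha : a = 0 := norm_eq_zero.1 (by linarith [norm_nonneg a, norm_nonneg b])
      have hb : b = 0 := norm_eq_zero.1 (by linarith [norm_nonneg a, norm_nonneg b])
      have hT1 : T = 0 := le_antisymm (by linarith) hT0
      have hw : w = w' := by
        rw [hT1] at hTt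
        have : twoPow 0 (1 + δ₂ - δ₁) (1 + δ₂' - δ₁') = 0 := by simp [twoPow, hρ.ne']
        exact sub_eq_zero.1 (norm_eq_zero.1 (hTt.symm.trans this))
      subst ha hb hw
      rw [sub_self, abs_zero]; positivity
    · have h2 : ∀ e, s ≤ 2 * ‖e‖ → |h (joinComp e w) - h (joinComp e w')| ≤ B * Δ := fun e he => by
        rw [hΔe]; exact hh.abs_sub_comp₂_le hδ₂ hδ₂' hK e w w' hs1 he
      rcases le_total ‖b‖ ‖a‖ with hab | hab
      · have h3 := h2 a (by linarith)
        have h4 := hr h hc hh a b w'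
        have h5 := abs_sub_le (h (joinComp a w)) (h (joinComp a w')) (h (joinComp b w'))
        linarith
      · have h3 := h2 b (by linarith)
        have h4 := hr h hc hh a b w
        have h5 := abs_sub_le (h (joinComp a w)) (h (joinComp b w)) (h (joinComp b w'))
        linarith
  · push Not at hTs
    have hT1 : 0 < T := hs0.trans_lt hTs
    rw [max_eq_right hTs.le] at hΔe
    -- As `|w - w'| = T^(ρ,ρ')` and `ρ - δ₂ = 1 - δ₁`, the cost of the `x₂` move at level `T`
    -- matches that of travelling out to this level.
    have hΔT : twoPow T (1 - δ₁) (1 - δ₁') = Δ := by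
      rw [hΔe, ← hTt, eq_div_iff (twoPow_pos hT1).ne', ← twoPow_add hT1]; congr 1 <;> ring
    -- A vector of norm `T` in `ℝⁿ` exists because `n ≥ 1`.
    let e : EuclideanSpace ℝ (Fin n) := EuclideanSpace.single ⟨0, hn⟩ T
    have he : ‖e‖ = T := by simp [e, abs_of_pos hT1]
    have move : ∀ (c : EuclideanSpace ℝ (Fin n)) (u : EuclideanSpace ℝ (Fin m)), ‖c‖ ≤ T →
        |h (joinComp c u) - h (joinComp e u)| ≤ A / 2 * Δ := fun c u hc' => by
      refine (hr h hc hh c e u).trans ?_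
      have hpos : 0 < ‖c‖ + ‖e‖ := by rw [he]; positivity
      have h1 : ‖c - e‖ / twoPow (‖c‖ + ‖e‖) δ₁ δ₁' ≤ 2 ^ (1 - δ₁ + (1 - δ₁')) * Δ := by
        calc _ ≤ (‖c‖ + ‖e‖) / twoPow (‖c‖ + ‖e‖) δ₁ δ₁' := by
              have := twoPow_pos hpos (α := δ₁) (α' := δ₁')
              gcongr; exact norm_sub_le _ _
          _ = twoPow (‖c‖ + ‖e‖) (1 - δ₁) (1 - δ₁') := by
              rw [div_eq_iff (twoPow_pos hpos).ne', twoPow_one_sub_mul hpos]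
          _ ≤ twoPow (2 * T) (1 - δ₁) (1 - δ₁') :=
              twoPow_mono hpos.le (by linarith) (by linarith) (by linarith)
          _ ≤ _ := by
              rw [← hΔT]
              exact twoPow_dilate_le (by norm_num) hT0 (by linarith) (by linarith)
      calc _ ≤ K₁ * (2 ^ (1 - δ₁ + (1 - δ₁')) * Δ) := by gcongr
        _ = _ := by rw [hA]; ring
    have h1 := move a w (by linarith [norm_nonneg b])
    have h2 := move b w' (by linarith [norm_nonneg a])
    have h3 := hh.abs_sub_comp₂_le hδ₂ hδ₂' hK e w w' hT1 (by linarith)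
    rw [← hΔe] at h3
    have h4 := abs_sub_le (h (joinComp a w)) (h (joinComp e w)) (h (joinComp b w'))
    have h5 := abs_sub_le (h (joinComp e w)) (h (joinComp e w')) (h (joinComp b w'))
    rw [abs_sub_comm (h (joinComp b w'))] at h2
    have n5 := mul_nonneg hK₁ hD
    linarith

end Grushin

/-! ### Explicit trial functions and the equivalence of the distance with `D_δ`. -/

section Distance

variable {n m : ℕ} {δ₁ δ₂ δ₁' δ₂' : ℝ}
  {C : RnRm n m → Matrix (Fin n ⊕ Fin m) (Fin n ⊕ Fin m) ℝ}

lemma abs_min_sub_min_le (a b c : ℝ) : |min a c - min b c| ≤ |a - b| := by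
  simpa using abs_min_sub_min_le_max a c b c

lemma ofReal_mul_sub_le_riemDist {κ : ℝ} {ψ : RnRm n m → ℝ}
    (h : (fun x => κ * ψ x) ∈ trialFunctions C) (x y : RnRm n m) {c : ℝ} (hc : c ≤ κ * (ψ x - ψ y)) :
    ENNReal.ofReal c ≤ riemDist C x y := by
  unfold riemDist
  refine le_trans (ENNReal.ofReal_le_ofReal ?_)
    (le_iSup₂ (f := fun ψ (_ : ψ ∈ trialFunctions C) => ENNReal.ofReal (ψ x - ψ y)) _ h)
  simpa [mul_sub] using hc

/-- The test function detecting the increment of `x₁`. -/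
lemma exists_le_riemDist_comp₁ (hδ₁ : 0 ≤ δ₁) (hδ₁' : 0 ≤ δ₁') (hδ₂ : 0 ≤ δ₂)
    (hδ₂' : 0 ≤ δ₂') (hC : HasGrushinBounds δ₁ δ₂ δ₁' δ₂' C) :
    ∃ κ : ℝ, 0 < κ ∧ ∀ x y : RnRm n m, ENNReal.ofReal
      (κ * (‖comp₁ x - comp₁ y‖ / twoPow (‖comp₁ x‖ + ‖comp₁ y‖) δ₁ δ₁')) ≤ riemDist C x y := by
  obtain ⟨κ, hκ, h⟩ := exists_smul_mem_trialFunctions hδ₁ hδ₁' hδ₂ hδ₂' hC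
  refine ⟨κ / 2 ^ (δ₁ + δ₁'), by positivity, fun x y => ?_⟩
  set s := ‖comp₁ x‖ + ‖comp₁ y‖ with hs
  rcases (show 0 ≤ s by positivity).eq_or_lt with h0 | hs0
  · have : ‖comp₁ x - comp₁ y‖ = 0 :=
      le_antisymm (by linarith [norm_sub_le (comp₁ x) (comp₁ y)]) (norm_nonneg _)
    simp [this]
  have hp : 0 < twoPow (2 * s) δ₁ δ₁' := twoPow_pos (by positivity)
  have hp' : 0 < twoPow s δ₁ δ₁' := twoPow_pos hs0
  -- Beyond `|z₁| = 2s` one has `|z₁ - y₁| ≥ s`, so the truncation at height `s` makes the function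
  -- constant there.
  refine ofReal_mul_sub_le_riemDist (h (2 * s)
    (fun z => min ‖comp₁ z - comp₁ y‖ s / twoPow (2 * s) δ₁ δ₁')
    (s / twoPow (2 * s) δ₁ δ₁') (s / twoPow (2 * s) δ₁ δ₁') (by positivity) ?_ ?_ ?_) x y ?_
  · intro z
    rw [abs_of_nonneg (by positivity)]
    gcongr; exact min_le_right _ _
  · intro z w
    rw [← sub_div, abs_div, abs_of_pos hp]
    refine le_add_of_le_of_nonneg ?_ (div_nonneg (norm_nonneg _) (twoPow_nonneg (by positivity)))
    gcongr
    refine (abs_min_sub_min_le _ _ _).trans ((abs_norm_sub_norm_le _ _).trans_eq ?_)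
    congr 1; abel
  · intro z hz
    rw [min_eq_right]
    have := norm_sub_norm_le (comp₁ z) (comp₁ y)
    linarith [norm_nonneg (comp₁ x)]
  · rw [min_eq_left (norm_sub_le _ _), sub_self, norm_zero, min_eq_left hs0.le, zero_div, sub_zero]
    have h1 := div_twoPow_div_le (norm_nonneg (comp₁ x - comp₁ y)) hs0 one_le_two hδ₁ hδ₁'
    rw [div_mul_eq_mul_div, div_le_iff₀ (by positivity)]
    calc _ ≤ _ := mul_le_mul_of_nonneg_left h1 hκ.le
      _ = _ := by ring

/-- The test function detecting the increment of `x₂`. -/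
lemma exists_le_riemDist_comp₂ (hδ₁ : 0 ≤ δ₁) (hδ₁' : 0 ≤ δ₁') (hδ₁_lt : δ₁ < 1)
    (hδ₁'_lt : δ₁' < 1) (hδ₂ : 0 ≤ δ₂)
    (hδ₂' : 0 ≤ δ₂') (hC : HasGrushinBounds δ₁ δ₂ δ₁' δ₂' C) :
    ∃ κ : ℝ, 0 < κ ∧ ∀ x y : RnRm n m, ENNReal.ofReal
      (κ * grushinΔ δ₁ δ₂ δ₁' δ₂' x y) ≤ riemDist C x y := by
  obtain ⟨κ, hκ, h⟩ := exists_smul_mem_trialFunctions hδ₁ hδ₁' hδ₂ hδ₂' hC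
  have hρ : 0 < 1 + δ₂ - δ₁ := by linarith
  have hρ' : 0 < 1 + δ₂' - δ₁' := by linarith
  set l : ℝ := 2 ^ (δ₁ + δ₁') with hl
  have hl1 : 1 ≤ l := Real.one_le_rpow one_le_two (by positivity)
  have hl0 : 0 < l := by positivity
  refine ⟨κ / l / 2 ^ (δ₂ + δ₂'), by positivity, fun x y => ?_⟩
  rw [grushinΔ_eq hδ₁_lt hδ₁'_lt hδ₂ hδ₂']
  have hT := twoPow_twoPow_inv (norm_nonneg (comp₂ x - comp₂ y)) hρ hρ'
  have hTS : twoPow ‖comp₂ x - comp₂ y‖ (1 + δ₂ - δ₁)⁻¹ (1 + δ₂' - δ₁')⁻¹ ≤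
    grushinScale δ₁ δ₂ δ₁' δ₂' x y := le_max_right _ _
  have hsS : ‖comp₁ x‖ + ‖comp₁ y‖ ≤ grushinScale δ₁ δ₂ δ₁' δ₂' x y := le_max_left _ _
  have hS0 : 0 ≤ grushinScale δ₁ δ₂ δ₁' δ₂' x y := grushinScale_nonneg x y
  set S := grushinScale δ₁ δ₂ δ₁' δ₂' x y
  have htS := twoPow_mono (twoPow_nonneg (norm_nonneg _)) hTS hρ.le hρ'.le
  rw [hT] at htS
  rcases hS0.eq_or_lt with h0 | hS
  · have : ‖comp₂ x - comp₂ y‖ = 0 := by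
      refine le_antisymm (htS.trans_eq ?_) (norm_nonneg _)
      rw [← h0]; simp [twoPow, hρ.ne']
    simp [this]
  -- The largest height compatible with a cut-off of slope `1/S`: the product has `x₁`-slope `W/S`,
  -- and `W / S / S^(δ₂,δ₂') = 1 / S^(δ₁,δ₁')`. Since `|x₂ - y₂| ≤ W`, the truncation does not
  -- affect the value at `x`.
  set W := twoPow S (1 + δ₂ - δ₁) (1 + δ₂' - δ₁') with hW
  have hW0 : 0 < W := twoPow_pos hS
  have hP₁ : 0 < twoPow S δ₁ δ₁' := twoPow_pos hS
  have hP₂ : 0 < twoPow S δ₂ δ₂' := twoPow_pos hS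
  have hP₁' : 0 < twoPow (2 * S) δ₁ δ₁' := twoPow_pos (by positivity)
  have hP₂' : 0 < twoPow (2 * S) δ₂ δ₂' := twoPow_pos (by positivity)
  have hWe : W * twoPow S δ₁ δ₁' = S * twoPow S δ₂ δ₂' := by
    conv_rhs => rw [← twoPow_one_one (a := S)]
    rw [twoPow_one_one, hW, ← twoPow_add hS]
    nth_rewrite 2 [← twoPow_one_one (a := S)]
    rw [← twoPow_add hS]; congr 1 <;> ring
  -- Equal to `1` for `|z₁| ≤ S` and to `0` for `|z₁| ≥ 2S`.
  let η : RnRm n m → ℝ := fun z => max 0 (min (2 - ‖comp₁ z‖ / S) 1)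
  have hη0 : ∀ z, 0 ≤ η z := fun z => le_max_left _ _
  have hη1 : ∀ z, η z ≤ 1 := fun z => max_le zero_le_one (min_le_right _ _)
  have hηL : ∀ z w, |η z - η w| ≤ ‖comp₁ z - comp₁ w‖ / S := fun z w => by
    have h1 : |η z - η w| ≤ |min (2 - ‖comp₁ z‖ / S) 1 - min (2 - ‖comp₁ w‖ / S) 1| := by
      simpa using abs_max_sub_max_le_max 0 (min (2 - ‖comp₁ z‖ / S) 1) 0
        (min (2 - ‖comp₁ w‖ / S) 1)
    refine h1.trans ((abs_min_sub_min_le _ _ _).trans ?_)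
    rw [sub_sub_sub_cancel_left, ← sub_div, abs_div, abs_of_pos hS, norm_sub_rev]
    gcongr
    exact abs_norm_sub_norm_le _ _
  let ζ : RnRm n m → ℝ := fun z => min ‖comp₂ z - comp₂ y‖ W
  have hζ0 : ∀ z, 0 ≤ ζ z := fun z => le_min (norm_nonneg _) hW0.le
  have hζ1 : ∀ z, ζ z ≤ W := fun z => min_le_right _ _
  have hζL : ∀ z w, |ζ z - ζ w| ≤ ‖comp₂ z - comp₂ w‖ := fun z w => by
    refine (abs_min_sub_min_le _ _ _).trans ((abs_norm_sub_norm_le _ _).trans_eq ?_)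
    congr 1; abel
  refine ofReal_mul_sub_le_riemDist (h (2 * S)
    (fun z => η z * ζ z / twoPow (2 * S) δ₂ δ₂' / l)
    (1 * W / twoPow (2 * S) δ₂ δ₂' / l) 0 (by positivity) ?_ ?_ ?_) x y ?_
  · intro z
    have := hη0 z
    have := hζ0 z
    rw [abs_of_nonneg (by positivity)]
    gcongr
    exacts [hη1 z, hζ1 z]
  · intro z w
    have e1 : |η z * ζ z - η w * ζ w| ≤ ‖comp₁ z - comp₁ w‖ / S * W + ‖comp₂ z - comp₂ w‖ := by
      calc _ = |(η z - η w) * ζ z + η w * (ζ z - ζ w)| := by ring_nf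
        _ ≤ |η z - η w| * ζ z + η w * |ζ z - ζ w| := by
          refine (abs_add_le _ _).trans_eq ?_
          rw [abs_mul, abs_mul, abs_of_nonneg (hζ0 z), abs_of_nonneg (hη0 w)]
        _ ≤ ‖comp₁ z - comp₁ w‖ / S * W + 1 * ‖comp₂ z - comp₂ w‖ := by
          gcongr
          exacts [hηL z w, hζ1 z, hη1 w, hζL z w]
        _ = _ := by ring
    rw [← sub_div, ← sub_div, abs_div, abs_div, abs_of_pos hP₂', abs_of_pos hl0]
    -- The factor `l` pays for replacing `S` by `2S` in the power with exponents `δ₁, δ₁'`.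
    have e2 : ‖comp₁ z - comp₁ w‖ / S * W / twoPow (2 * S) δ₂ δ₂' / l ≤
        ‖comp₁ z - comp₁ w‖ / twoPow (2 * S) δ₁ δ₁' := by
      have f1 : twoPow (2 * S) δ₁ δ₁' ≤ l * twoPow S δ₁ δ₁' :=
        twoPow_dilate_le one_le_two hS.le hδ₁ hδ₁'
      have f2 : twoPow S δ₂ δ₂' ≤ twoPow (2 * S) δ₂ δ₂' :=
        twoPow_mono hS.le (by linarith) hδ₂ hδ₂'
      have f3 : W * twoPow (2 * S) δ₁ δ₁' ≤ S * twoPow (2 * S) δ₂ δ₂' * l := by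
        calc _ ≤ W * (l * twoPow S δ₁ δ₁') := by gcongr
          _ = S * twoPow S δ₂ δ₂' * l := by rw [← hWe]; ring
          _ ≤ _ := by gcongr
      have f4 : W / S / twoPow (2 * S) δ₂ δ₂' / l ≤ 1 / twoPow (2 * S) δ₁ δ₁' := by
        rw [div_div, div_div, div_le_div_iff₀ (by positivity) hP₁']
        linarith
      calc _ = ‖comp₁ z - comp₁ w‖ * (W / S / twoPow (2 * S) δ₂ δ₂' / l) := by ring
        _ ≤ ‖comp₁ z - comp₁ w‖ * (1 / twoPow (2 * S) δ₁ δ₁') := by gcongr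
        _ = _ := by ring
    calc _ ≤ (‖comp₁ z - comp₁ w‖ / S * W + ‖comp₂ z - comp₂ w‖) /
          twoPow (2 * S) δ₂ δ₂' / l := by gcongr
      _ = ‖comp₁ z - comp₁ w‖ / S * W / twoPow (2 * S) δ₂ δ₂' / l +
          ‖comp₂ z - comp₂ w‖ / twoPow (2 * S) δ₂ δ₂' / l := by ring
      _ ≤ _ := add_le_add e2 (div_le_self (by positivity) hl1)
  · intro z hz
    have : η z = 0 := by
      refine max_eq_left ((min_le_left _ _).trans ?_)
      rw [sub_nonpos, le_div_iff₀ hS]; exact hz.le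
    simp [this]
  · have e1 : η x = 1 := by
      have : ‖comp₁ x‖ / S ≤ 1 := by
        rw [div_le_one hS]; linarith [norm_nonneg (comp₁ y)]
      show max 0 (min (2 - ‖comp₁ x‖ / S) 1) = 1
      rw [min_eq_right (by linarith), max_eq_right zero_le_one]
    have e2 : ζ x = ‖comp₂ x - comp₂ y‖ := min_eq_left htS
    have e3 : ζ y = 0 := by
      show min ‖comp₂ y - comp₂ y‖ W = 0
      rw [sub_self, norm_zero, min_eq_left hW0.le]
    rw [e1, e2, e3]
    have h1 := div_twoPow_div_le (norm_nonneg (comp₂ x - comp₂ y)) hS one_le_two hδ₂ hδ₂'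
    calc κ / l / 2 ^ (δ₂ + δ₂') * (‖comp₂ x - comp₂ y‖ / twoPow S δ₂ δ₂') ≤
        κ / l / 2 ^ (δ₂ + δ₂') *
          (2 ^ (δ₂ + δ₂') * (‖comp₂ x - comp₂ y‖ / twoPow (2 * S) δ₂ δ₂')) := by gcongr
      _ = _ := by field_simp; ring

theorem distEquivGrushin_of_hasGrushinBounds (hn : 1 ≤ n) (hδ₁ : 0 ≤ δ₁) (hδ₁' : 0 ≤ δ₁')
    (hδ₁_lt : δ₁ < 1) (hδ₁'_lt : δ₁' < 1) (hδ₂ : 0 ≤ δ₂)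
    (hδ₂' : 0 ≤ δ₂') (hC : HasGrushinBounds δ₁ δ₂ δ₁' δ₂' C) :
    DistEquivGrushin δ₁ δ₂ δ₁' δ₂' C := by
  obtain ⟨κ₁, hκ₁, h₁⟩ := exists_le_riemDist_comp₁ hδ₁ hδ₁' hδ₂ hδ₂' hC
  obtain ⟨κ₂, hκ₂, h₂⟩ := exists_le_riemDist_comp₂ hδ₁ hδ₁' hδ₁_lt hδ₁'_lt hδ₂ hδ₂' hC
  obtain ⟨K, hK, hS⟩ := trialFunctions_abs_sub_le hδ₁ hδ₁' hδ₂ hδ₂' hC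
  obtain ⟨K₁, hK₁, hU⟩ := IsSegmentLipschitz.abs_sub_le_grushinD (m := m) hn hδ₁ hδ₁' hδ₁_lt
    hδ₁'_lt hδ₂ hδ₂' hK
  -- The halving bounds a sum of two terms by the larger one. The added `1` makes the upper constant
  -- positive.
  refine ⟨min κ₁ κ₂ / 2, K₁ + 1, by positivity, by positivity, fun x y => ⟨?_, ?_⟩⟩
  · have hD := norm_sub_div_twoPow_nonneg (comp₁ x) (comp₁ y) δ₁ δ₁'
    have hΔ := grushinΔ_nonneg (δ₁ := δ₁) (δ₂ := δ₂) (δ₁' := δ₁') (δ₂' := δ₂') x y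
    unfold grushinD
    have m1 := mul_le_mul_of_nonneg_right (min_le_left κ₁ κ₂) hD
    have m2 := mul_le_mul_of_nonneg_right (min_le_right κ₁ κ₂) hΔ
    rcases le_total (min κ₁ κ₂ *
      (‖comp₁ x - comp₁ y‖ / twoPow (‖comp₁ x‖ + ‖comp₁ y‖) δ₁ δ₁'))
      (min κ₁ κ₂ * grushinΔ δ₁ δ₂ δ₁' δ₂' x y) with h | h
    · exact (ENNReal.ofReal_le_ofReal (by linarith)).trans (h₂ x y)
    · exact (ENNReal.ofReal_le_ofReal (by linarith)).trans (h₁ x y)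
  · refine iSup₂_le fun ψ hψ => ENNReal.ofReal_le_ofReal ?_
    have hψc : Continuous ψ := by obtain ⟨g, hg, -⟩ := hψ; exact hg.continuous
    have h1 := hU ψ hψc (hS ψ hψ) x y
    have hD : 0 ≤ grushinD δ₁ δ₂ δ₁' δ₂' x y :=
      add_nonneg (norm_sub_div_twoPow_nonneg _ _ _ _) (grushinΔ_nonneg x y)
    linarith [le_abs_self (ψ x - ψ y)]

end Distance

/-! ### Comparison of balls with boxes, and their volume. -/

section Volume

variable {n m : ℕ} {δ₁ δ₂ δ₁' δ₂' : ℝ}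

/-- The product of a cube of half side `r₁` in `ℝⁿ` and a cube of half side `r₂` in `ℝᵐ`. -/
def coordBox (x : RnRm n m) (r₁ r₂ : ℝ) : Set (RnRm n m) :=
  {y | (∀ i, |y (Sum.inl i) - x (Sum.inl i)| < r₁) ∧ ∀ j, |y (Sum.inr j) - x (Sum.inr j)| < r₂}

lemma volume_coordBox (x : RnRm n m) {r₁ r₂ : ℝ} (h₁ : 0 ≤ r₁) (h₂ : 0 ≤ r₂) :
    volume (coordBox x r₁ r₂) = ENNReal.ofReal ((2 * r₁) ^ n * (2 * r₂) ^ m) := by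
  have he : coordBox x r₁ r₂ = (WithLp.ofLp : RnRm n m → (Fin n ⊕ Fin m → ℝ)) ⁻¹'
      (Set.univ.pi fun k => Set.Ioo (x k - Sum.elim (fun _ => r₁) (fun _ => r₂) k)
        (x k + Sum.elim (fun _ => r₁) (fun _ => r₂) k)) := by
    ext y
    simp only [coordBox, Set.mem_ofPred_eq, Set.mem_preimage, Set.mem_univ_pi, Sum.forall,
      Sum.elim_inl, Sum.elim_inr, abs_lt, Set.mem_Ioo]
    refine and_congr (forall_congr' fun i => ?_) (forall_congr' fun i => ?_) <;>
      constructor <;> rintro ⟨h, h'⟩ <;> constructor <;> linarith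
  rw [he, (PiLp.volume_preserving_ofLp (Fin n ⊕ Fin m)).measure_preimage
    (MeasurableSet.univ_pi fun _ => measurableSet_Ioo).nullMeasurableSet, Real.volume_pi_Ioo,
    Fintype.prod_sum_type]
  simp only [Sum.elim_inl, Sum.elim_inr, add_sub_sub_cancel, Finset.prod_const, Finset.card_univ,
    Fintype.card_fin, ← two_mul]
  rw [ENNReal.ofReal_mul (p := (2 * r₁) ^ n) (by positivity), ENNReal.ofReal_pow (by positivity),
    ENNReal.ofReal_pow (by positivity)]

lemma norm_le_card_mul {ι : Type*} [Fintype ι] (x : EuclideanSpace ℝ ι) {r : ℝ}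
    (h : ∀ i, |x i| ≤ r) : ‖x‖ ≤ Fintype.card ι * r := by
  classical
  have : x = ∑ i, x i • EuclideanSpace.single i (1 : ℝ) := by
    ext j; simp [Pi.single_apply]
  rw [this]
  refine (norm_sum_le _ _).trans ((Finset.sum_le_card_nsmul _ _ r fun i _ => ?_).trans_eq
    (by simp))
  simpa [norm_smul] using h i

lemma norm_comp_sub_le_of_mem_coordBox {x y : RnRm n m} {r₁ r₂ : ℝ} (h₁ : 0 ≤ r₁) (h₂ : 0 ≤ r₂)
    (h : y ∈ coordBox x r₁ r₂) : ‖comp₁ x - comp₁ y‖ ≤ (n + m) * r₁ ∧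
      ‖comp₂ x - comp₂ y‖ ≤ (n + m) * r₂ := by
  have a1 := norm_le_card_mul (comp₁ y - comp₁ x) (r := r₁) fun i => (h.1 i).le
  have a2 := norm_le_card_mul (comp₂ y - comp₂ x) (r := r₂) fun i => (h.2 i).le
  rw [Fintype.card_fin, norm_sub_rev] at a1 a2
  have b1 : 0 ≤ (m : ℝ) * r₁ := by positivity
  have b2 : 0 ≤ (n : ℝ) * r₂ := by positivity
  constructor <;> linarith

lemma mem_coordBox_of_norm_lt {x y : RnRm n m} {r₁ r₂ : ℝ} (h₁ : ‖comp₁ x - comp₁ y‖ < r₁)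
    (h₂ : ‖comp₂ x - comp₂ y‖ < r₂) : y ∈ coordBox x r₁ r₂ := by
  rw [norm_sub_rev] at h₁ h₂
  exact ⟨fun i => (abs_apply_le_norm (comp₁ y - comp₁ x) i).trans_lt h₁,
    fun i => (abs_apply_le_norm (comp₂ y - comp₂ x) i).trans_lt h₂⟩

/-- A ball of radius at most `Y^(1-δ₁,1-δ₁')`, with centre within `Y` of the degeneracy, is
contained in the expected box. -/
lemma norm_lt_of_grushinD_lt (hδ₁ : 0 ≤ δ₁) (hδ₁' : 0 ≤ δ₁') (hδ₁_lt : δ₁ < 1)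
    (hδ₁'_lt : δ₁' < 1) (hδ₂ : 0 ≤ δ₂) (hδ₂' : 0 ≤ δ₂') {l : ℝ} (hl : 1 ≤ l) :
    ∃ K : ℝ, 0 < K ∧ ∀ (x y : RnRm n m) (r Y : ℝ), 0 < r → 0 < Y → ‖comp₁ x‖ ≤ Y →
      r ≤ twoPow Y (1 - δ₁) (1 - δ₁') → grushinD δ₁ δ₂ δ₁' δ₂' x y < l * r →
      ‖comp₁ x - comp₁ y‖ < K * (r * twoPow Y δ₁ δ₁') ∧
      ‖comp₂ x - comp₂ y‖ < K * (r * twoPow Y δ₂ δ₂') := by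
  set e := (1 - δ₁)⁻¹ + (1 - δ₁')⁻¹ with he
  have hθ : 0 < 1 - δ₁ := by linarith
  have hθ' : 0 < 1 - δ₁' := by linarith
  have he0 : 0 < e := by positivity
  have hρ : 0 < 1 + δ₂ - δ₁ := by linarith
  have hρ' : 0 < 1 + δ₂' - δ₁' := by linarith
  -- Chosen so that `|x₁| + |y₁|` and `|x₂ - y₂|^(1/ρ,1/ρ')` are both at most `M Y`. The first is
  -- either at most `4Y` or comparable to `|x₁ - y₁|`, and then the bound on `D_δ` limits it.
  set M : ℝ := 4 + (2 * l) ^ e with hM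
  have hl0 : 0 < l := by linarith
  have hM1 : 1 ≤ M := by rw [hM]; have : 0 < (2 * l) ^ e := by positivity
                         linarith
  have hM0 : 0 < M := by linarith
  have hA : 0 < M ^ (δ₁ + δ₁') := by positivity
  have hB : 0 < M ^ (δ₂ + δ₂') := by positivity
  refine ⟨l * (M ^ (δ₁ + δ₁') + M ^ (δ₂ + δ₂')), by positivity, ?_⟩
  intro x y r Y hr hY hxY hrY hD
  have hd0 := norm_sub_div_twoPow_nonneg (comp₁ x) (comp₁ y) δ₁ δ₁'
  have hΔ0 := grushinΔ_nonneg (δ₁ := δ₁) (δ₂ := δ₂) (δ₁' := δ₁') (δ₂' := δ₂') x y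
  have hΔe := grushinΔ_eq hδ₁_lt hδ₁'_lt hδ₂ hδ₂' x y
  unfold grushinD at hD
  have hd1 : ‖comp₁ x - comp₁ y‖ / twoPow (‖comp₁ x‖ + ‖comp₁ y‖) δ₁ δ₁' < l * r := by linarith
  have hΔ1 : grushinΔ δ₁ δ₂ δ₁' δ₂' x y < l * r := by linarith
  have hlr : l * r ≤ l * twoPow Y (1 - δ₁) (1 - δ₁') := by gcongr
  have hsM : ‖comp₁ x‖ + ‖comp₁ y‖ ≤ M * Y := by
    set s := ‖comp₁ x‖ + ‖comp₁ y‖ with hs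
    by_cases h4 : s ≤ 4 * Y
    · refine h4.trans ?_
      gcongr; rw [hM]; have : 0 < (2 * l) ^ e := by positivity
      linarith
    · push Not at h4
      have hs0 : 0 < s := by linarith
      have h1 : s / 2 ≤ ‖comp₁ x - comp₁ y‖ := by
        have := norm_sub_norm_le (comp₁ y) (comp₁ x)
        rw [norm_sub_rev] at this
        linarith
      have h2 : twoPow s (1 - δ₁) (1 - δ₁') ≤ 2 * l * twoPow Y (1 - δ₁) (1 - δ₁') := by
        have h3 : twoPow s (1 - δ₁) (1 - δ₁') ≤ 2 * (‖comp₁ x - comp₁ y‖ / twoPow s δ₁ δ₁') := by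
          rw [← mul_div_assoc, le_div_iff₀ (twoPow_pos hs0), twoPow_one_sub_mul hs0]; linarith
        linarith
      refine (le_of_twoPow_le hs0.le hY.le (by linarith) hθ hθ' h2).trans ?_
      gcongr; rw [hM]; linarith
  have hTM : twoPow ‖comp₂ x - comp₂ y‖ (1 + δ₂ - δ₁)⁻¹ (1 + δ₂' - δ₁')⁻¹ ≤ M * Y := by
    have hTt := twoPow_twoPow_inv (norm_nonneg (comp₂ x - comp₂ y)) hρ hρ'
    have hT0 : 0 ≤ twoPow ‖comp₂ x - comp₂ y‖ (1 + δ₂ - δ₁)⁻¹ (1 + δ₂' - δ₁')⁻¹ :=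
      twoPow_nonneg (norm_nonneg _)
    unfold grushinScale at hΔe
    set T := twoPow ‖comp₂ x - comp₂ y‖ (1 + δ₂ - δ₁)⁻¹ (1 + δ₂' - δ₁')⁻¹
    by_cases hTs : T ≤ ‖comp₁ x‖ + ‖comp₁ y‖
    · exact hTs.trans hsM
    · push Not at hTs
      have hT1 : 0 < T := lt_of_le_of_lt (by positivity) hTs
      have hΔT : twoPow T (1 - δ₁) (1 - δ₁') = grushinΔ δ₁ δ₂ δ₁' δ₂' x y := by
        rw [hΔe, max_eq_right hTs.le, ← hTt, eq_div_iff (twoPow_pos hT1).ne', ← twoPow_add hT1]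
        congr 1 <;> ring
      have h2 : twoPow T (1 - δ₁) (1 - δ₁') ≤ 2 * l * twoPow Y (1 - δ₁) (1 - δ₁') := by
        have : 0 ≤ l * twoPow Y (1 - δ₁) (1 - δ₁') := by
          have := twoPow_nonneg hY.le (α := 1 - δ₁) (α' := 1 - δ₁'); positivity
        linarith
      refine (le_of_twoPow_le hT0 hY.le (by linarith) hθ hθ' h2).trans ?_
      gcongr; rw [hM]; linarith
  have hlr0 : 0 < l * r := by positivity
  have hY1 : 0 < twoPow Y δ₁ δ₁' := twoPow_pos hY
  have hY2 : 0 < twoPow Y δ₂ δ₂' := twoPow_pos hY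
  constructor
  · have h1 : ‖comp₁ x - comp₁ y‖ ≤ l * r * twoPow (‖comp₁ x‖ + ‖comp₁ y‖) δ₁ δ₁' := by
      rcases (show 0 ≤ ‖comp₁ x‖ + ‖comp₁ y‖ by positivity).eq_or_lt with h | h
      · have h2 := norm_sub_le (comp₁ x) (comp₁ y)
        rw [← h] at h2 ⊢
        exact h2.trans (mul_nonneg hlr0.le (twoPow_nonneg le_rfl))
      · exact ((div_le_iff₀ (twoPow_pos h)).1 hd1.le)
    have h2 : twoPow (‖comp₁ x‖ + ‖comp₁ y‖) δ₁ δ₁' ≤ M ^ (δ₁ + δ₁') * twoPow Y δ₁ δ₁' :=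
      (twoPow_mono (by positivity) hsM hδ₁ hδ₁').trans (twoPow_dilate_le hM1 hY.le hδ₁ hδ₁')
    have h3 : 0 < l * r * (M ^ (δ₂ + δ₂') * twoPow Y δ₁ δ₁') := by positivity
    calc _ ≤ _ := h1
      _ ≤ l * r * (M ^ (δ₁ + δ₁') * twoPow Y δ₁ δ₁') := by gcongr
      _ < _ := by linarith
  · have h1 : ‖comp₂ x - comp₂ y‖ ≤ l * r * twoPow (grushinScale δ₁ δ₂ δ₁' δ₂' x y) δ₂ δ₂' := by
      rcases (grushinScale_nonneg (δ₁ := δ₁) (δ₂ := δ₂) (δ₁' := δ₁') (δ₂' := δ₂') x y).eq_or_lt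
        with h | h
      · have hT : twoPow ‖comp₂ x - comp₂ y‖ (1 + δ₂ - δ₁)⁻¹ (1 + δ₂' - δ₁')⁻¹ ≤
          grushinScale δ₁ δ₂ δ₁' δ₂' x y := le_max_right _ _
        rw [← h] at hT ⊢
        have : ‖comp₂ x - comp₂ y‖ ≤ 0 := by
          by_contra h'
          push Not at h'
          exact absurd (twoPow_pos h') (not_lt.2 hT)
        exact this.trans (mul_nonneg hlr0.le (twoPow_nonneg le_rfl))
      · rw [hΔe] at hΔ1
        exact ((div_le_iff₀ (twoPow_pos h)).1 hΔ1.le)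
    have h2 : twoPow (grushinScale δ₁ δ₂ δ₁' δ₂' x y) δ₂ δ₂' ≤
        M ^ (δ₂ + δ₂') * twoPow Y δ₂ δ₂' :=
      (twoPow_mono (grushinScale_nonneg x y) (max_le hsM hTM) hδ₂ hδ₂').trans
        (twoPow_dilate_le hM1 hY.le hδ₂ hδ₂')
    have h3 : 0 < l * r * (M ^ (δ₁ + δ₁') * twoPow Y δ₂ δ₂') := by positivity
    calc _ ≤ _ := h1
      _ ≤ l * r * (M ^ (δ₂ + δ₂') * twoPow Y δ₂ δ₂') := by gcongr
      _ < _ := by linarith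

/-- Away from the degeneracy, small boxes have small diameter. -/
lemma grushinD_le_of_norm_le (hδ₁ : 0 ≤ δ₁) (hδ₁' : 0 ≤ δ₁') (hδ₁_lt : δ₁ < 1)
    (hδ₁'_lt : δ₁' < 1) (hδ₂ : 0 ≤ δ₂) (hδ₂' : 0 ≤ δ₂') {x y : RnRm n m} {Y q : ℝ} (hY : 0 < Y)
    (hx : Y ≤ ‖comp₁ x‖) (h₁ : ‖comp₁ x - comp₁ y‖ ≤ q * twoPow Y δ₁ δ₁')
    (h₂ : ‖comp₂ x - comp₂ y‖ ≤ q * twoPow Y δ₂ δ₂') :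
    grushinD δ₁ δ₂ δ₁' δ₂' x y ≤ 2 * q := by
  have hs : Y ≤ ‖comp₁ x‖ + ‖comp₁ y‖ := by linarith [norm_nonneg (comp₁ y)]
  have hS : Y ≤ grushinScale δ₁ δ₂ δ₁' δ₂' x y := hs.trans (le_max_left _ _)
  unfold grushinD
  rw [grushinΔ_eq hδ₁_lt hδ₁'_lt hδ₂ hδ₂', two_mul]
  have hY1 : 0 < twoPow Y δ₁ δ₁' := twoPow_pos hY
  have hY2 : 0 < twoPow Y δ₂ δ₂' := twoPow_pos hY
  refine add_le_add ?_ ?_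
  · refine (div_le_div_of_nonneg_left (norm_nonneg _) hY1 (twoPow_mono hY.le hs hδ₁ hδ₁')).trans ?_
    rwa [div_le_iff₀ hY1]
  · refine (div_le_div_of_nonneg_left (norm_nonneg _) hY2 (twoPow_mono hY.le hS hδ₂ hδ₂')).trans ?_
    rwa [div_le_iff₀ hY2]

/-- At scale `R`, small boxes have small diameter, whatever the position of their centre. -/
lemma grushinD_le_of_norm_le_scale (hδ₁ : 0 ≤ δ₁) (hδ₁' : 0 ≤ δ₁') (hδ₁_lt : δ₁ < 1)
    (hδ₁'_lt : δ₁' < 1) (hδ₂ : 0 ≤ δ₂) (hδ₂' : 0 ≤ δ₂') {x y : RnRm n m} {R l θ : ℝ} (hR : 0 < R)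
    (hl : 0 < l) (hl1 : l ≤ 1) (hθ : θ ≤ 1 - δ₁) (hθ' : θ ≤ 1 - δ₁')
    (hθρ : θ ≤ (1 - δ₁) / (1 + δ₂ - δ₁)) (hθρ' : θ ≤ (1 - δ₁') / (1 + δ₂' - δ₁'))
    (h₁ : ‖comp₁ x - comp₁ y‖ ≤ l * R)
    (h₂ : ‖comp₂ x - comp₂ y‖ ≤ l * twoPow R (1 + δ₂ - δ₁) (1 + δ₂' - δ₁')) :
    grushinD δ₁ δ₂ δ₁' δ₂' x y ≤ 2 * (l ^ θ * twoPow R (1 - δ₁) (1 - δ₁')) := by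
  have hρ : 0 < 1 + δ₂ - δ₁ := by linarith
  have hρ' : 0 < 1 + δ₂' - δ₁' := by linarith
  have hnn : 0 ≤ l ^ θ * twoPow R (1 - δ₁) (1 - δ₁') :=
    mul_nonneg (by positivity) (twoPow_nonneg hR.le)
  unfold grushinD
  rw [grushinΔ_eq hδ₁_lt hδ₁'_lt hδ₂ hδ₂', two_mul]
  -- The denominators only decrease when their bases are replaced by `|x₁ - y₁|` and `|x₂ -
  -- y₂|^(1/ρ,1/ρ')`. What remains are nonnegative powers of the increments alone, so the position
  -- of the centre drops out.
  refine add_le_add ?_ ?_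
  · rcases (norm_nonneg (comp₁ x - comp₁ y)).eq_or_lt with h | h
    · rw [← h, zero_div]; exact hnn
    · calc _ ≤ ‖comp₁ x - comp₁ y‖ / twoPow ‖comp₁ x - comp₁ y‖ δ₁ δ₁' :=
            div_le_div_of_nonneg_left h.le (twoPow_pos h)
              (twoPow_mono h.le (norm_sub_le _ _) hδ₁ hδ₁')
        _ = twoPow ‖comp₁ x - comp₁ y‖ (1 - δ₁) (1 - δ₁') := by
            rw [div_eq_iff (twoPow_pos h).ne', twoPow_one_sub_mul h]
        _ ≤ twoPow (l * R) (1 - δ₁) (1 - δ₁') :=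
            twoPow_mono h.le h₁ (by linarith) (by linarith)
        _ ≤ _ := twoPow_contract_le hl hl1 hR.le hθ hθ'
  · rcases (norm_nonneg (comp₂ x - comp₂ y)).eq_or_lt with h | h
    · rw [← h, zero_div]; exact hnn
    · have hT : 0 < twoPow ‖comp₂ x - comp₂ y‖ (1 + δ₂ - δ₁)⁻¹ (1 + δ₂' - δ₁')⁻¹ := twoPow_pos h
      have hg : ∀ d r : ℝ, 0 < 1 + d - r → (1 - r) / (1 + d - r) = 1 - (1 + d - r)⁻¹ * d :=
        fun d r hdr => by field_simp; ring
      calc _ ≤ ‖comp₂ x - comp₂ y‖ /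
            twoPow (twoPow ‖comp₂ x - comp₂ y‖ (1 + δ₂ - δ₁)⁻¹ (1 + δ₂' - δ₁')⁻¹) δ₂ δ₂' :=
            div_le_div_of_nonneg_left h.le (twoPow_pos hT)
              (twoPow_mono hT.le (le_max_right _ _) hδ₂ hδ₂')
        _ = twoPow ‖comp₂ x - comp₂ y‖ ((1 - δ₁) / (1 + δ₂ - δ₁))
              ((1 - δ₁') / (1 + δ₂' - δ₁')) := by
            rw [twoPow_twoPow h.le (inv_pos.2 hρ) (inv_pos.2 hρ'),
              div_eq_iff (twoPow_pos h).ne', hg _ _ hρ, hg _ _ hρ', twoPow_one_sub_mul h]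
        _ ≤ twoPow (l * twoPow R (1 + δ₂ - δ₁) (1 + δ₂' - δ₁')) ((1 - δ₁) / (1 + δ₂ - δ₁))
              ((1 - δ₁') / (1 + δ₂' - δ₁')) :=
            twoPow_mono h.le h₂ (div_nonneg (by linarith) hρ.le) (div_nonneg (by linarith) hρ'.le)
        _ ≤ l ^ θ * twoPow (twoPow R (1 + δ₂ - δ₁) (1 + δ₂' - δ₁')) ((1 - δ₁) / (1 + δ₂ - δ₁))
              ((1 - δ₁') / (1 + δ₂' - δ₁')) :=
            twoPow_contract_le hl hl1 (twoPow_nonneg hR.le) hθρ hθρ'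
        _ = _ := by
            rw [twoPow_twoPow hR.le hρ hρ', mul_div_cancel₀ _ hρ.ne', mul_div_cancel₀ _ hρ'.ne']

/-- Both regimes are instances of `key`, which differ in the choice of `Y`: it is `|x₁|` for small
radii and the solution of `Y^(1-δ₁,1-δ₁') = r` for large ones. -/
theorem ballVolumeEquivGrushin_of_distEquivGrushin (hn : 1 ≤ n) (hδ₁ : 0 ≤ δ₁) (hδ₁' : 0 ≤ δ₁')
    (hδ₁_lt : δ₁ < 1) (hδ₁'_lt : δ₁' < 1) (hδ₂ : 0 ≤ δ₂) (hδ₂' : 0 ≤ δ₂')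
    {C : RnRm n m → Matrix (Fin n ⊕ Fin m) (Fin n ⊕ Fin m) ℝ}
    (hC : DistEquivGrushin δ₁ δ₂ δ₁' δ₂' C) : BallVolumeEquivGrushin δ₁ δ₂ δ₁' δ₂' C := by
  obtain ⟨a, a', ha, ha', hd⟩ := hC
  have hθ : 0 < 1 - δ₁ := by linarith
  have hθ' : 0 < 1 - δ₁' := by linarith
  have hρ : 0 < 1 + δ₂ - δ₁ := by linarith
  have hρ' : 0 < 1 + δ₂' - δ₁' := by linarith
  have hN : 0 < (n : ℝ) + m := by
    have : (1 : ℝ) ≤ n := by exact_mod_cast hn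
    positivity
  obtain ⟨K, hK, hout⟩ := norm_lt_of_grushinD_lt (n := n) (m := m) hδ₁ hδ₁' hδ₁_lt hδ₁'_lt hδ₂ hδ₂'
    (l := 1 + 1 / a) (by have : 0 < 1 / a := by positivity
                         linarith)
  set θ := min (min (1 - δ₁) (1 - δ₁'))
    (min ((1 - δ₁) / (1 + δ₂ - δ₁)) ((1 - δ₁') / (1 + δ₂' - δ₁'))) with hθdef
  have hθ0 : 0 < θ := by positivity
  have hθ1 : θ ≤ 1 := (min_le_left _ _).trans ((min_le_left _ _).trans (by linarith))
  -- Makes `a' * (2 * μ) < 1` strictly, as the open ball needs. The box is shrunk by `l = μ^(1/θ)`,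
  -- so that `l ^ θ = μ` serves the large radii and `l ≤ μ` the small ones.
  set μ := 1 / (2 * a' + 2) with hμ
  have hμ0 : 0 < μ := by positivity
  have hμ1 : μ ≤ 1 := by rw [hμ, div_le_one (by positivity)]; linarith
  have hμa : a' * (2 * μ) < 1 := by
    rw [hμ, ← mul_div_assoc, ← mul_div_assoc, div_lt_one (by positivity)]; linarith
  set l := μ ^ (1 / θ) with hl
  have hl0 : 0 < l := by positivity
  have hlθ : l ^ θ = μ := by rw [hl, ← Real.rpow_mul hμ0.le, one_div_mul_cancel hθ0.ne',
    Real.rpow_one]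
  have hl1 : l ≤ 1 := Real.rpow_le_one hμ0.le hμ1 (by positivity)
  have hlμ : l ≤ μ := by
    calc l = l ^ (1 : ℝ) := (Real.rpow_one l).symm
      _ ≤ l ^ θ := Real.rpow_le_rpow_of_exponent_ge hl0 hl1 hθ1
      _ = μ := hlθ
  have key : ∀ (x : RnRm n m) (r Y : ℝ), 0 < r → 0 < Y → ‖comp₁ x‖ ≤ Y →
      r ≤ twoPow Y (1 - δ₁) (1 - δ₁') → (Y ≤ ‖comp₁ x‖ ∨ r = twoPow Y (1 - δ₁) (1 - δ₁')) →
      ENNReal.ofReal ((2 * l / (n + m)) ^ (n + m) *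
        (r ^ (n + m) * twoPow Y (n * δ₁ + m * δ₂) (n * δ₁' + m * δ₂'))) ≤
          volume (riemBall C x r) ∧
      volume (riemBall C x r) ≤ ENNReal.ofReal ((2 * K) ^ (n + m) *
        (r ^ (n + m) * twoPow Y (n * δ₁ + m * δ₂) (n * δ₁' + m * δ₂'))) := by
    intro x r Y hr hY hxY hrY hcase
    have hY1 : 0 < twoPow Y δ₁ δ₁' := twoPow_pos hY
    have hY2 : 0 < twoPow Y δ₂ δ₂' := twoPow_pos hY
    have hvol : ∀ k : ℝ, 0 ≤ k → volume (coordBox x (k * (r * twoPow Y δ₁ δ₁'))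
        (k * (r * twoPow Y δ₂ δ₂'))) = ENNReal.ofReal ((2 * k) ^ (n + m) *
        (r ^ (n + m) * twoPow Y (n * δ₁ + m * δ₂) (n * δ₁' + m * δ₂'))) := fun k hk => by
      rw [volume_coordBox x (by positivity) (by positivity), twoPow_add hY, ← twoPow_pow hY.le,
        ← twoPow_pow hY.le]
      congr 1
      simp only [mul_pow, pow_add]
      ring
    constructor
    -- The division by `n + m` compensates the passage from coordinate bounds to Euclidean norms.
    · have h1 := hvol (l / (n + m)) (by positivity)
      rw [← mul_div_assoc] at h1
      rw [← h1]
      refine measure_mono fun y hy => ?_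
      obtain ⟨h2, h3⟩ := norm_comp_sub_le_of_mem_coordBox (by positivity) (by positivity) hy
      rw [← mul_assoc, mul_div_cancel₀ _ hN.ne'] at h2 h3
      have h4 : grushinD δ₁ δ₂ δ₁' δ₂' x y ≤ 2 * (μ * r) := by
        rcases hcase with hc | hc
        · refine grushinD_le_of_norm_le hδ₁ hδ₁' hδ₁_lt hδ₁'_lt hδ₂ hδ₂' hY hc
            (h2.trans ?_) (h3.trans ?_)
          · rw [← mul_assoc]; gcongr
          · rw [← mul_assoc]; gcongr
        · have e1 : r * twoPow Y δ₁ δ₁' = Y := by rw [hc, twoPow_one_sub_mul hY]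
          have e2 : r * twoPow Y δ₂ δ₂' = twoPow Y (1 + δ₂ - δ₁) (1 + δ₂' - δ₁') := by
            rw [hc, ← twoPow_add hY]; congr 1 <;> ring
          rw [e1] at h2
          rw [e2] at h3
          have := grushinD_le_of_norm_le_scale (θ := θ) hδ₁ hδ₁' hδ₁_lt hδ₁'_lt hδ₂ hδ₂' hY hl0 hl1
            ((min_le_left _ _).trans (min_le_left _ _))
            ((min_le_left _ _).trans (min_le_right _ _))
            ((min_le_right _ _).trans (min_le_left _ _))
            ((min_le_right _ _).trans (min_le_right _ _)) h2 h3
          rwa [hlθ, ← hc] at this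
      refine (hd x y).2.trans_lt ((ENNReal.ofReal_lt_ofReal_iff hr).2 ?_)
      calc a' * grushinD δ₁ δ₂ δ₁' δ₂' x y ≤ a' * (2 * (μ * r)) := by gcongr
        _ = a' * (2 * μ) * r := by ring
        _ < 1 * r := by gcongr
        _ = r := one_mul r
    · rw [← hvol K hK.le]
      refine measure_mono fun y hy => ?_
      have h1 := (hd x y).1.trans_lt hy
      rw [ENNReal.ofReal_lt_ofReal_iff hr] at h1
      have h2 : grushinD δ₁ δ₂ δ₁' δ₂' x y < (1 + 1 / a) * r := by
        have : grushinD δ₁ δ₂ δ₁' δ₂' x y < r / a := by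
          rw [lt_div_iff₀ ha]; linarith
        calc _ < r / a := this
          _ ≤ r + r / a := by linarith
          _ = _ := by ring
      obtain ⟨h3, h4⟩ := hout x y r Y hr hY hxY hrY h2
      exact mem_coordBox_of_norm_lt h3 h4
  refine ⟨(2 * l / (n + m)) ^ (n + m), (2 * K) ^ (n + m), by positivity, by positivity,
    fun x r hr => ⟨fun hxr => ?_, fun hxr => ?_⟩⟩
  · set R := twoPow r (1 - δ₁)⁻¹ (1 - δ₁')⁻¹ with hRdef
    have hR : 0 < R := twoPow_pos hr
    have hRr : twoPow R (1 - δ₁) (1 - δ₁') = r := twoPow_twoPow_inv hr.le hθ hθ'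
    have hxR : ‖comp₁ x‖ ≤ R := by
      have := twoPow_mono (twoPow_nonneg (norm_nonneg _)) hxr (inv_pos.2 hθ).le (inv_pos.2 hθ').le
      rwa [twoPow_inv_twoPow (norm_nonneg _) hθ hθ'] at this
    have e : r ^ (n + m) * twoPow R (n * δ₁ + m * δ₂) (n * δ₁' + m * δ₂') =
        twoPow r (grushinDim n m δ₁ δ₂) (grushinDim n m δ₁' δ₂') := by
      -- This is `D = n + m + β / (1 - δ₁)`, the exponent of `r^(n+m) R^β` with `R = r^(1/(1-δ₁))`.
      have hdim : ∀ d₁ d₂ : ℝ, 0 < 1 - d₁ → grushinDim n m d₁ d₂ =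
          ((n + m : ℕ) : ℝ) * 1 + (1 - d₁)⁻¹ * (n * d₁ + m * d₂) := fun d₁ d₂ h => by
        unfold grushinDim; push_cast; field_simp; ring
      rw [hdim _ _ hθ, hdim _ _ hθ', twoPow_add hr, ← twoPow_pow hr.le, twoPow_one_one, hRdef,
        twoPow_twoPow hr.le (inv_pos.2 hθ) (inv_pos.2 hθ')]
    rw [← e]
    exact key x r R hr hR hxR hRr.ge (Or.inr hRr.symm)
  · have hx : 0 < ‖comp₁ x‖ := by
      rcases (norm_nonneg (comp₁ x)).eq_or_lt with h | h
      · rw [← h] at hxr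
        have : twoPow 0 (1 - δ₁) (1 - δ₁') = 0 := by simp [twoPow, hθ.ne']
        linarith
      · exact h
    exact key x r ‖comp₁ x‖ hr hx le_rfl hxr (Or.inl le_rfl)

end Volume

lemma CoeffEquiv.refl {ι : Type*} [Fintype ι] (C : EuclideanSpace ℝ ι → Matrix ι ι ℝ) :
    CoeffEquiv C C :=
  ⟨1, 1, one_pos, one_pos, Filter.Eventually.of_forall fun x => by
    simp [Matrix.PosSemidef.zero]⟩

theorem proposition5p1 (n m : ℕ) (hn : 1 ≤ n) (δ₁ δ₂ δ₁' δ₂' : ℝ)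
    (hδ₁ : 0 ≤ δ₁) (hδ₁_lt : δ₁ < 1) (hδ₁' : 0 ≤ δ₁') (hδ₁'_lt : δ₁' < 1)
    (hδ₂ : 0 ≤ δ₂) (hδ₂' : 0 ≤ δ₂')
    (c₁ c₂ : EuclideanSpace ℝ (Fin n) → ℝ)
    (hc₁ : IsGrushinCoeff δ₁ δ₁' c₁) (hc₂ : IsGrushinCoeff δ₂ δ₂' c₂)
    (C : RnRm n m → Matrix (Fin n ⊕ Fin m) (Fin n ⊕ Fin m) ℝ)
    (hC_meas : ∀ i j, AEMeasurable (fun x => C x i j) volume)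
    (hC : CoeffEquiv C (blockCoeff c₁ c₂)) :
    DistEquivGrushin δ₁ δ₂ δ₁' δ₂' (blockCoeff (m := m) c₁ c₂) ∧
    BallVolumeEquivGrushin δ₁ δ₂ δ₁' δ₂' (blockCoeff (m := m) c₁ c₂) ∧
    DistEquivGrushin δ₁ δ₂ δ₁' δ₂' C ∧
    BallVolumeEquivGrushin δ₁ δ₂ δ₁' δ₂' C := by
  have hB := hasGrushinBounds_of_coeffEquiv hc₁ hc₂ (CoeffEquiv.refl (blockCoeff (m := m) c₁ c₂))
  have hB' := hasGrushinBounds_of_coeffEquiv hc₁ hc₂ hC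
  have hD := distEquivGrushin_of_hasGrushinBounds hn hδ₁ hδ₁' hδ₁_lt hδ₁'_lt hδ₂ hδ₂' hB
  have hD' := distEquivGrushin_of_hasGrushinBounds hn hδ₁ hδ₁' hδ₁_lt hδ₁'_lt hδ₂ hδ₂' hB'
  exact ⟨hD, ballVolumeEquivGrushin_of_distEquivGrushin hn hδ₁ hδ₁' hδ₁_lt hδ₁'_lt hδ₂ hδ₂' hD, hD',
    ballVolumeEquivGrushin_of_distEquivGrushin hn hδ₁ hδ₁' hδ₁_lt hδ₁'_lt hδ₂ hδ₂' hD'⟩
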